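/- For a lattice $L$ in an $m$-dimensional Euclidean space $V\cong\mathbb{R}^m$, equip $V/L$ with the metric $d(x,y)=\min\{\|s-t\|_2: s\in x,\ t\in y\}$. A lattice code in $V/L$ is a set of the form $(TL)/L$, where $T=cQ$ with $c>0$ and $Q$ a linear isometry of $V$, and $L\subseteq TL$. A set $C\subseteq V/L$ with $n$ points is an optimal code of size $n$ if its minimum distance $\min\{d(x,y):x,y\in C,\ x\neq y\}$ is the largest among all $n$-point subsets of $V/L$ (for $n=1$, every one-point set is optimal). Let $\ell(L)$ be the smallest norm of a nonzero vector of $L$, and put $$N(L)=\{\|\ell(L)^{-1}v\|_2^m : v\in L\setminus\{0\}\},\qquad n_L=\min(N(L)\setminus\{1\}).$$ Let $A_n$ be the set of points of $\mathbb{Z}^{n+1}$ with coordinate sum $0$, viewed as a lattice in the hyperplane $\{x\in\mathbb{R}^{n+1}:\sum_i x_i=0\}\cong\mathbb{R}^n$; let $D_n\subseteq\mathbb{R}^n$ be the set of points of $\mathbb{Z}^n$ with even coordinate sum; and let $E_8\subseteq\mathbb{R}^8$ be the set of points of $\mathbb{Z}^8\cup(\mathbb{Z}+\tfrac12)^8$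 with even coordinate sum. **Theorem.** We have $n_{A_1}=2$, $n_{A_2}=3$, $n_{D_4}=4$ and $n_{E_8}=16$. For each $L\in\{A_1,A_2,D_4,E_8\}$, with ambient space $V$, there is a lattice code of size $n_L$ in $V/L$, and every lattice code $C$ of size $n_L$ in $V/L$ has the following properties: $C$ is an optimal code; every optimal code of size $n_L$ in $V/L$ is mapped onto $C$ by some isometry of $V/L$ onto itself; and every optimal code of size $n_L-1$ in $V/L$ is mapped onto a subset of $C$ by some isometry of $V/L$ onto itself. -/

import Mathlib

/-! ### The lattices -/

/-- The hyperplane `span {(1, …, 1)}ᗮ` of `ℝ^(n+1)`, an `n`-dimensional Euclidean space. -/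
noncomputable abbrev SumZero (n : ℕ) : Submodule ℝ (EuclideanSpace ℝ (Fin (n + 1))) :=
  (Submodule.span ℝ {WithLp.toLp 2 (fun _ : Fin (n + 1) => (1 : ℝ))})ᗮ

/-- The lattice `A_n`: the points of the hyperplane `span {(1, …, 1)}ᗮ` of `ℝ^(n+1)` with integer
coordinates (lying in the hyperplane says that the coordinates sum to zero). -/
def latticeA (n : ℕ) : AddSubgroup (SumZero n) where
  carrier := {x | ∀ i, ∃ k : ℤ, (x : EuclideanSpace ℝ (Fin (n + 1))) i = k}
  zero_mem' := fun _ => ⟨0, by simp⟩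
  add_mem' := by
    intro x y hx hy i
    obtain ⟨a, ha⟩ := hx i
    obtain ⟨b, hb⟩ := hy i
    exact ⟨a + b, by simp [ha, hb]⟩
  neg_mem' := by
    intro x hx i
    obtain ⟨a, ha⟩ := hx i
    exact ⟨-a, by simp [ha]⟩

/-- The lattice `D_n`: the points of `ℤ^n` whose coordinates sum to an even number. -/
def latticeD (n : ℕ) : AddSubgroup (EuclideanSpace ℝ (Fin n)) where
  carrier := {x | (∀ i, ∃ k : ℤ, x i = k) ∧ ∃ s : ℤ, ∑ i, x i = 2 * s}
  zero_mem' := ⟨fun _ => ⟨0, by simp⟩, 0, by simp⟩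
  add_mem' := by
    rintro x y ⟨hx, s, hs⟩ ⟨hy, t, ht⟩
    refine ⟨fun i => ?_, s + t, ?_⟩
    · obtain ⟨a, ha⟩ := hx i
      obtain ⟨b, hb⟩ := hy i
      exact ⟨a + b, by simp [ha, hb]⟩
    · simp [Finset.sum_add_distrib, hs, ht, mul_add]
  neg_mem' := by
    rintro x ⟨hx, s, hs⟩
    refine ⟨fun i => ?_, -s, ?_⟩
    · obtain ⟨a, ha⟩ := hx i
      exact ⟨-a, by simp [ha]⟩
    · simp [hs]

/-- The lattice `E_8`: the points of `ℤ^8 ∪ (ℤ + 1/2)^8` whose coordinates sum to an even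
number. -/
def latticeE8 : AddSubgroup (EuclideanSpace ℝ (Fin 8)) where
  carrier := {x | ((∀ i, ∃ k : ℤ, x i = k) ∨ (∀ i, ∃ k : ℤ, x i = k + 1 / 2)) ∧
    ∃ s : ℤ, ∑ i, x i = 2 * s}
  zero_mem' := ⟨Or.inl fun _ => ⟨0, by simp⟩, 0, by simp⟩
  add_mem' := by
    rintro x y ⟨hx, s, hs⟩ ⟨hy, t, ht⟩
    refine ⟨?_, s + t, ?_⟩
    · rcases hx with hx | hx <;> rcases hy with hy | hy
      · left
        intro i
        obtain ⟨a, ha⟩ := hx i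
        obtain ⟨b, hb⟩ := hy i
        exact ⟨a + b, by simp [ha, hb]⟩
      · right
        intro i
        obtain ⟨a, ha⟩ := hx i
        obtain ⟨b, hb⟩ := hy i
        exact ⟨a + b, by simp [ha, hb]; ring⟩
      · right
        intro i
        obtain ⟨a, ha⟩ := hx i
        obtain ⟨b, hb⟩ := hy i
        exact ⟨a + b, by simp [ha, hb]; ring⟩
      · left
        intro i
        obtain ⟨a, ha⟩ := hx i
        obtain ⟨b, hb⟩ := hy i
        exact ⟨a + b + 1, by simp [ha, hb]; ring⟩
    · simp [Finset.sum_add_distrib, hs, ht, mul_add]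
  neg_mem' := by
    rintro x ⟨hx, s, hs⟩
    refine ⟨?_, -s, ?_⟩
    · rcases hx with hx | hx
      · left
        intro i
        obtain ⟨a, ha⟩ := hx i
        exact ⟨-a, by simp [ha]⟩
      · right
        intro i
        obtain ⟨a, ha⟩ := hx i
        exact ⟨-a - 1, by simp [ha]; ring⟩
    · simp [hs]

/-! ### Codes in metric spaces -/

/-- `C` is an optimal code of size `n` in `M`: it has exactly `n` points, and its minimum distance
is the largest among all `n`-point subsets of `M`. `Set.einfsep` is the infimum of the distances
between distinct points; for a set with at most one point it is `⊤`, so that every one-point set is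
an optimal code of size `1`. -/
def IsOptimalCode {M : Type*} [PseudoMetricSpace M] (n : ℕ) (C : Set M) : Prop :=
  C.encard = n ∧ ∀ C' : Set M, C'.encard = n → C'.einfsep ≤ C.einfsep

/-! ### Lattice codes

Here `V` plays the role of `ℝ^m`. The space `V ⧸ L` carries Mathlib's quotient metric,
`dist x y = inf {‖s - t‖ : s ∈ x, t ∈ y}`. -/

section LatticeCodes

variable {V : Type*} [NormedAddCommGroup V] [InnerProductSpace ℝ V]

/-- `ℓ(L)`, the smallest norm of a nonzero vector of the lattice `L`. -/
noncomputable def minNorm (L : AddSubgroup V) : ℝ :=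
  sInf {r : ℝ | ∃ v ∈ L, v ≠ 0 ∧ r = ‖v‖}

/-- `N(L) = {‖z‖ ^ m : z ∈ ℓ(L)⁻¹ L, z ≠ 0}`, where `m = dim V`. -/
noncomputable def codeSizes (L : AddSubgroup V) : Set ℝ :=
  {r : ℝ | ∃ v ∈ L, v ≠ 0 ∧ r = ‖(minNorm L)⁻¹ • v‖ ^ Module.finrank ℝ V}

/-- `T` belongs to the conformal orthogonal group `{c Q : c > 0, Q ∈ O(V)}`. -/
def IsConformalOrthogonal (T : V →ₗ[ℝ] V) : Prop :=
  ∃ c : ℝ, 0 < c ∧ ∃ Q : V ≃ₗᵢ[ℝ] V, ∀ x, T x = c • Q x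

/-- `C` is a lattice code in `V ⧸ L`: `C = (T L) / L` for some `T` in the conformal orthogonal
group such that `T L` contains `L`. -/
def IsLatticeCode (L : AddSubgroup V) (C : Set (V ⧸ L)) : Prop :=
  ∃ T : V →ₗ[ℝ] V, IsConformalOrthogonal T ∧ L ≤ L.map T.toAddMonoidHom ∧
    C = (fun x : V => (x : V ⧸ L)) '' (L.map T.toAddMonoidHom : Set V)

/-- The lattice code of size `n` in `V ⧸ L` exists, it is an optimal code, it is the only optimal
code of size `n` up to isometries of `V ⧸ L`, and every optimal code of size `n - 1` is carried into
it by an isometry of `V ⧸ L`. (This is asserted for every lattice code `C` of size `n`;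
in particular, any two of them are related by an isometry.) -/
def LatticeCodeUniquelyOptimal (L : AddSubgroup V) (n : ℕ) : Prop :=
  (∃ C : Set (V ⧸ L), IsLatticeCode L C ∧ C.encard = n) ∧
  ∀ C : Set (V ⧸ L), IsLatticeCode L C → C.encard = n →
    IsOptimalCode n C ∧
    (∀ D : Set (V ⧸ L), IsOptimalCode n D → ∃ φ : (V ⧸ L) ≃ᵢ (V ⧸ L), φ '' D = C) ∧
    (∀ D : Set (V ⧸ L), IsOptimalCode (n - 1) D → ∃ φ : (V ⧸ L) ≃ᵢ (V ⧸ L), φ '' D ⊆ C)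

end LatticeCodes

/-! ### The quotient norm on `V ⧸ L`. -/

section Quotient

variable {V : Type*} [NormedAddCommGroup V] {L : AddSubgroup V}

/-! In each of the four lattices the shortest vectors have squared norm 2, the next squared norm is
some `s`, and every point lies within `√(4 / s)` of the lattice. Comparing covolumes, `T` gives a
code of size `n` exactly when it scales squared norms by `2 / s`, so distinct code points are at
least `√(4 / s)` apart. No two points of `V ⧸ L` are farther apart than that, hence the code is
optimal, and every optimal code of size `n` or `n - 1` is also separated by `√(4 / s)`. It remains
to move any such separated set `D`, translated to contain 0, into the lattice code `C` by an
isometry (`HasTightSublattice.latticeCodeUniquelyOptimal`).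

For `A₁`, `A₂` and `D₄` the points at maximal distance from 0 form so few classes that, with 0, they
are exactly `C`; no motion is needed (`latticeCodeUniquelyOptimal_of_few_holes`).

`E₈` is even and self-dual, and its deep holes are halves of lattice vectors. On `½L / L` the
squared norm modulo 1 is a quadratic form over `𝔽₂`; differences in `D` are singular and `C` is a
maximal totally singular subspace. A point `u` of `D` outside `C` is not orthogonal to some `w` in
`C`, so `u + w` is nonsingular and is the class of half a root. Reflection in that root carries `u`
to `w` modulo `L` and fixes `D ∩ C`; induction on the number of points of `D` outside `C` finishes,
in the manner of Witt's theorem (`latticeCodeUniquelyOptimal_of_even_of_selfDual`).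

The covering radii and deep holes come from inequalities on the Voronoi cell. -/

theorem discreteTopology_of_le_norm_sq {r : ℝ} (hr : 0 < r)
    (h : ∀ v ∈ L, v ≠ 0 → r ≤ ‖v‖ ^ 2) : DiscreteTopology L := by
  refine DiscreteTopology.of_forall_le_norm (r := √r) (by positivity) fun v hv => ?_
  refine Real.sqrt_le_iff.2 ⟨norm_nonneg _, ?_⟩
  exact h v v.2 (by simpa using hv)

theorem le_norm_mk_iff {r : ℝ} {x : V} :
    r ≤ ‖(x : V ⧸ L)‖ ↔ ∀ v ∈ L, r ≤ ‖x - v‖ := by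
  rw [← not_lt, QuotientAddGroup.norm_lt_iff]
  push Not
  constructor
  · intro h v hv
    refine h (x - v) ?_
    rw [QuotientAddGroup.eq]
    simpa using hv
  · intro h m hm
    rw [QuotientAddGroup.eq] at hm
    have := h (-m + x) hm
    rwa [show x - (-m + x) = m by abel] at this

theorem norm_mk_le_norm_sub {x v : V} (hv : v ∈ L) : ‖(x : V ⧸ L)‖ ≤ ‖x - v‖ :=
  le_norm_mk_iff.1 le_rfl v hv

variable [InnerProductSpace ℝ V]

/-- A linear isometry of `V` that maps `L` onto itself induces an isometry of `V ⧸ L`. -/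
theorem exists_isometryEquiv_quotient (Q : V ≃ₗᵢ[ℝ] V) (hQ : ∀ v, Q v ∈ L ↔ v ∈ L) :
    ∃ φ : (V ⧸ L) ≃ᵢ (V ⧸ L), ∀ x : V, φ (x : V ⧸ L) = (Q x : V ⧸ L) := by
  have hmap : L.map (Q.toLinearEquiv.toAddEquiv : V →+ V) = L := by
    ext v
    constructor
    · rintro ⟨w, hw, rfl⟩
      exact (hQ w).2 hw
    · intro hv
      refine ⟨Q.symm v, (hQ _).1 (by simpa using hv), by simp⟩
  let e : (V ⧸ L) ≃+ (V ⧸ L) := QuotientAddGroup.congr L L Q.toLinearEquiv.toAddEquiv hmap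
  have he : ∀ x : V, e (x : V ⧸ L) = (Q x : V ⧸ L) := fun x => rfl
  refine ⟨⟨e.toEquiv, AddMonoidHomClass.isometry_of_norm e.toAddMonoidHom ?_⟩, he⟩
  intro x
  induction x using QuotientAddGroup.induction_on with
  | H x =>
    change ‖((Q x : V) : V ⧸ L)‖ = ‖(x : V ⧸ L)‖
    refine le_antisymm (le_norm_mk_iff.2 fun v hv => ?_) (le_norm_mk_iff.2 fun v hv => ?_)
    · have := norm_mk_le_norm_sub (x := Q x) ((hQ v).2 hv)
      rwa [← map_sub, Q.norm_map] at this
    · have := norm_mk_le_norm_sub (x := x) (L := L) ((hQ (Q.symm v)).1 (by simpa using hv))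
      rwa [← Q.norm_map, map_sub, Q.apply_symm_apply] at this

end Quotient

/-! ### Closest lattice vectors, and the index of a lattice in a similar one. -/

section Lattice

variable {V : Type*} [NormedAddCommGroup V] [InnerProductSpace ℝ V]

theorem exists_forall_norm_sub_le [FiniteDimensional ℝ V] (L : AddSubgroup V) [DiscreteTopology L]
    (x : V) : ∃ v ∈ L, ∀ w ∈ L, ‖x - v‖ ≤ ‖x - w‖ := by
  obtain ⟨v, hv, h⟩ := (AddSubgroup.isClosed_of_discrete (H := L)).exists_infDist_eq_dist
    ⟨0, L.zero_mem⟩ x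
  refine ⟨v, hv, fun w hw => ?_⟩
  rw [← dist_eq_norm, ← h, ← dist_eq_norm]
  exact Metric.infDist_le_dist_of_mem hw

/-- Large multiples of a nonzero vector orthogonal to `L` are arbitrarily far from `L`. -/
theorem span_eq_top_of_cover [FiniteDimensional ℝ V] {L : AddSubgroup V} {r : ℝ}
    (h : ∀ x, ∃ v ∈ L, ‖x - v‖ ^ 2 ≤ r) : Submodule.span ℝ (L : Set V) = ⊤ := by
  rw [← Submodule.orthogonal_eq_bot_iff, Submodule.eq_bot_iff]
  intro x hx
  by_contra hne
  have hpos : 0 < ‖x‖ ^ 2 := by positivity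
  obtain ⟨k, hk⟩ := exists_nat_gt (max r 1 / ‖x‖ ^ 2)
  rw [div_lt_iff₀ hpos] at hk
  obtain ⟨v, hv, hle⟩ := h ((k : ℝ) • x)
  have h0 : inner ℝ x v = 0 := by
    rw [real_inner_comm]
    exact hx v (Submodule.subset_span hv)
  rw [norm_sub_sq_real, inner_smul_left, h0, norm_smul, mul_pow] at hle
  simp only [Real.norm_natCast, mul_zero, sub_zero] at hle
  have h1 : (k : ℝ) ≤ (k : ℝ) ^ 2 := by exact_mod_cast Nat.le_self_pow two_ne_zero k
  nlinarith [le_max_left r 1, sq_nonneg ‖v‖]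

/-- The code has as many points as the index of `L` in `TL`, which is the quotient of the covolumes;
`T` multiplies covolume by `|det T| = c ^ m`. -/
theorem exists_encard_latticeCode [FiniteDimensional ℝ V] {L : AddSubgroup V} {r : ℝ} (hr : 0 < r)
    (hmin : ∀ v ∈ L, v ≠ 0 → r ≤ ‖v‖ ^ 2) (hL : Submodule.span ℝ (L : Set V) = ⊤) {T : V →ₗ[ℝ] V} {c : ℝ} (hc : 0 < c)
    (Q : V ≃ₗᵢ[ℝ] V) (hT : ∀ x, T x = c • Q x) (hLT : L ≤ L.map T.toAddMonoidHom) :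
    ∃ k : ℕ, (k : ℝ) * c ^ Module.finrank ℝ V = 1 ∧
      ((fun x : V => (x : V ⧸ L)) '' (L.map T.toAddMonoidHom : Set V)).encard = k := by
  classical
  borelize V
  set M := L.map T.toAddMonoidHom with hM
  have hinj : Function.Injective T := fun x y hxy => by
    rw [hT, hT] at hxy
    exact Q.injective (smul_right_injective V hc.ne' hxy)
  have hdet : |LinearMap.det T| = c ^ Module.finrank ℝ V := by
    have : T = c • (Q.toLinearEquiv : V →ₗ[ℝ] V) := by
      ext x; simp [hT]
    rw [this, LinearMap.det_smul, abs_mul, abs_pow, abs_of_pos hc, ← LinearMap.normDet_eq_abs_det]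
    rw [show (Q.toLinearEquiv : V →ₗ[ℝ] V) = Q.toLinearIsometry.toLinearMap from rfl,
      LinearIsometry.normDet_eq_one, mul_one]
  have : DiscreteTopology L := discreteTopology_of_le_norm_sq hr hmin
  have : DiscreteTopology M := by
    refine discreteTopology_of_le_norm_sq (r := c ^ 2 * r) (by positivity) ?_
    rintro _ ⟨v, hv, rfl⟩ hne
    have hv0 : v ≠ 0 := by
      rintro rfl
      simp at hne
    change _ ≤ ‖T v‖ ^ 2
    rw [hT, norm_smul, Q.norm_map, mul_pow, Real.norm_eq_abs, sq_abs]
    exact mul_le_mul_of_nonneg_left (hmin v hv hv0) (sq_nonneg c)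
  have hMspan : Submodule.span ℝ (M : Set V) = ⊤ := by
    rw [eq_top_iff, ← hL]
    exact Submodule.span_mono hLT
  let L' : Submodule ℤ V := AddSubgroup.toIntSubmodule L
  let M' : Submodule ℤ V := AddSubgroup.toIntSubmodule M
  have : DiscreteTopology L' := ‹DiscreteTopology L›
  have : DiscreteTopology M' := ‹DiscreteTopology M›
  have : IsZLattice ℝ L' := ⟨hL⟩
  have : IsZLattice ℝ M' := ⟨hMspan⟩
  let b := Module.Free.chooseBasis ℤ L'
  let e : L' ≃ₗ[ℤ] M' := 
    (AddEquiv.toIntLinearEquiv (L.equivMapOfInjective T.toAddMonoidHom hinj))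
  have hcov : ZLattice.covolume M' = c ^ Module.finrank ℝ V * ZLattice.covolume L' := by
    let b₀ := b.ofZLatticeBasis ℝ L'
    rw [ZLattice.covolume_eq_det_mul_measureReal M' MeasureTheory.volume (b := b.map e) (b₀ := b₀),
      ZLattice.covolume_eq_det_mul_measureReal L' MeasureTheory.volume (b := b) (b₀ := b₀), ← mul_assoc, ← hdet, ← abs_mul,
      ← b₀.det_comp]
    rfl
  have hpos := ZLattice.covolume_pos L'
  have hrel := ZLattice.covolume_div_covolume_eq_relIndex' L' M' hLT
  rw [hcov] at hrel
  have hcp : 0 < c ^ Module.finrank ℝ V := by positivity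
  refine ⟨L'.toAddSubgroup.relIndex M'.toAddSubgroup, ?_, ?_⟩
  · rw [← hrel]
    field_simp
  · have hne : L'.toAddSubgroup.relIndex M'.toAddSubgroup ≠ 0 := by
      intro h0
      rw [h0] at hrel
      have : 0 < ZLattice.covolume L' / (c ^ Module.finrank ℝ V * ZLattice.covolume L') := by
        positivity
      simp [hrel] at this
    have hcard : L.relIndex M = Nat.card (M.map (QuotientAddGroup.mk' L)) := by
      rw [← AddSubgroup.relIndex_ker, QuotientAddGroup.ker_mk']
    change L.relIndex M ≠ 0 at hne
    change _ = ((L.relIndex M : ℕ) : ℕ∞)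
    rw [hcard] at hne ⊢
    have := Nat.finite_of_card_ne_zero hne
    rw [← ENat.card_eq_coe_natCard]
    rfl

end Lattice

/-! ### Codes whose minimum distance equals the covering radius. -/

section SimilarSublattice

variable {V : Type*} [NormedAddCommGroup V] [InnerProductSpace ℝ V]

/-- The nonzero vectors of `L` have squared norm `2` or at least `s`, both values being attained,
`L` has a similar sublattice of index `n = (s / 2) ^ (m / 2)` whose shortest vectors have squared
norm `s`, and the covering radius of `L` is at most `2 / √s`. -/
structure HasTightSublattice (L : AddSubgroup V) (s : ℝ) (n : ℕ) : Prop where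
  two_lt : 2 < s
  two_le : 2 ≤ n
  sq_card : (n : ℝ) ^ 2 = (s / 2) ^ Module.finrank ℝ V
  exists_norm_sq_eq_two : ∃ v ∈ L, ‖v‖ ^ 2 = 2
  exists_norm_sq_eq : ∃ v ∈ L, ‖v‖ ^ 2 = s
  norm_sq_gap : ∀ v ∈ L, v ≠ 0 → ‖v‖ ^ 2 = 2 ∨ s ≤ ‖v‖ ^ 2
  cover : ∀ x, ∃ v ∈ L, ‖x - v‖ ^ 2 ≤ 4 / s
  similar : ∃ S : V →ₗ[ℝ] V, (∀ x, ‖S x‖ ^ 2 = s / 2 * ‖x‖ ^ 2) ∧ ∀ v ∈ L, S v ∈ L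

namespace HasTightSublattice

variable {L : AddSubgroup V} {s : ℝ} {n : ℕ}

theorem two_le_norm_sq (h : HasTightSublattice L s n) {v : V} (hv : v ∈ L) (hne : v ≠ 0) :
    2 ≤ ‖v‖ ^ 2 := by
  rcases h.norm_sq_gap v hv hne with h1 | h1
  · exact h1.ge
  · exact h.two_lt.le.trans h1

theorem minNorm_eq (h : HasTightSublattice L s n) : minNorm L = √2 := by
  refine IsLeast.csInf_eq ⟨?_, ?_⟩
  · obtain ⟨v, hv, h2⟩ := h.exists_norm_sq_eq_two
    refine ⟨v, hv, ?_, ?_⟩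
    · rintro rfl
      simp at h2
    · rw [← h2, Real.sqrt_sq (norm_nonneg v)]
  · rintro _ ⟨v, hv, hne, rfl⟩
    exact Real.sqrt_le_iff.2 ⟨norm_nonneg _, h.two_le_norm_sq hv hne⟩

theorem isLeast_codeSizes (h : HasTightSublattice L s n) :
    IsLeast (codeSizes L \ {1}) (n : ℝ) := by
  have hs := h.two_lt
  have hn : (n : ℝ) = √(s / 2) ^ Module.finrank ℝ V := by
    rw [← sq_eq_sq₀ (by positivity) (by positivity), h.sq_card, ← pow_mul, mul_comm, pow_mul,
      Real.sq_sqrt (by linarith)]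
  have hnorm : ∀ v : V, ‖(minNorm L)⁻¹ • v‖ = √(‖v‖ ^ 2 / 2) := fun v => by
    rw [h.minNorm_eq, norm_smul, Real.sqrt_div (sq_nonneg _), Real.sqrt_sq (norm_nonneg _),
      norm_inv, Real.norm_of_nonneg (Real.sqrt_nonneg 2)]
    ring
  refine ⟨⟨?_, ?_⟩, ?_⟩
  · obtain ⟨v, hv, hvs⟩ := h.exists_norm_sq_eq
    refine ⟨v, hv, ?_, ?_⟩
    · rintro rfl
      simp at hvs
      linarith
    · rw [hnorm, hvs, hn]
  · have := h.two_le
    simp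
    omega
  · rintro _ ⟨⟨v, hv, hne, rfl⟩, h1⟩
    rw [hnorm] at h1 ⊢
    rcases h.norm_sq_gap v hv hne with h2 | h2
    · simp [h2] at h1
    · rw [hn]
      gcongr

theorem discreteTopology (h : HasTightSublattice L s n) : DiscreteTopology L :=
  discreteTopology_of_le_norm_sq two_pos fun _ hv hne => h.two_le_norm_sq hv hne

theorem norm_quotient_le (h : HasTightSublattice L s n) (x : V ⧸ L) : ‖x‖ ≤ √(4 / s) := by
  induction x using QuotientAddGroup.induction_on with
  | H x =>
    obtain ⟨v, hv, hle⟩ := h.cover x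
    exact (norm_mk_le_norm_sub hv).trans (Real.le_sqrt_of_sq_le hle)

theorem norm_sq_apply {T : V →ₗ[ℝ] V} {c : ℝ} (Q : V ≃ₗᵢ[ℝ] V) (hT : ∀ x, T x = c • Q x) (x : V) :
    ‖T x‖ ^ 2 = c ^ 2 * ‖x‖ ^ 2 := by
  rw [hT, norm_smul, Q.norm_map, mul_pow, Real.norm_eq_abs, sq_abs]

/-- Every representative of the class of `x` lies in `TL`, whose nonzero vectors have squared norm
at least `2 / s * 2`. -/
theorem le_norm_of_mem_code (h : HasTightSublattice L s n) {T : V →ₗ[ℝ] V}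
    (hT : ∀ x, ‖T x‖ ^ 2 = 2 / s * ‖x‖ ^ 2) (hLT : L ≤ L.map T.toAddMonoidHom) {x : V}
    (hx : x ∈ L.map T.toAddMonoidHom) (hne : (x : V ⧸ L) ≠ 0) : √(4 / s) ≤ ‖(x : V ⧸ L)‖ := by
  have hs := h.two_lt
  refine le_norm_mk_iff.2 fun v hv => Real.sqrt_le_iff.2 ⟨norm_nonneg _, ?_⟩
  obtain ⟨w, hw, hwe⟩ := sub_mem hx (hLT hv)
  rw [← hwe]
  change _ ≤ ‖T w‖ ^ 2
  rw [hT]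
  have hw0 : w ≠ 0 := by
    rintro rfl
    rw [map_zero] at hwe
    apply hne
    rw [QuotientAddGroup.eq_zero_iff, sub_eq_zero.1 hwe.symm]
    exact hv
  have := h.two_le_norm_sq hw hw0
  calc 4 / s = 2 / s * 2 := by ring
    _ ≤ _ := by gcongr

variable [FiniteDimensional ℝ V]

/-- The maps `T` that produce lattice codes of size `n` scale squared norms by `2 / s`. -/
theorem encard_latticeCode_iff (h : HasTightSublattice L s n) {T : V →ₗ[ℝ] V} {c : ℝ} (hc : 0 < c)
    (Q : V ≃ₗᵢ[ℝ] V) (hT : ∀ x, T x = c • Q x) (hLT : L ≤ L.map T.toAddMonoidHom) :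
    ((fun x : V => (x : V ⧸ L)) '' (L.map T.toAddMonoidHom : Set V)).encard = n ↔
      c ^ 2 = 2 / s := by
  obtain ⟨k, hk, hcard⟩ := exists_encard_latticeCode two_pos
    (fun _ hv hne => h.two_le_norm_sq hv hne) (span_eq_top_of_cover h.cover) hc Q hT hLT
  have hs := h.two_lt
  have hs' := h.sq_card
  have hn2 := h.two_le
  -- In dimension 0 the size would be 1; a positive exponent lets powers of `c ^ 2` be compared
  -- through their bases.
  have hm : Module.finrank ℝ V ≠ 0 := by
    intro h0
    rw [h0, pow_zero] at hs'
    have : (2 : ℝ) ≤ n := by exact_mod_cast hn2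
    nlinarith
  rw [hcard]
  have hcp : 0 < c ^ Module.finrank ℝ V := by positivity
  have hk2 : (k : ℝ) ^ 2 * (c ^ 2) ^ Module.finrank ℝ V = 1 := by
    rw [← pow_mul, mul_comm 2, pow_mul, ← mul_pow, hk, one_pow]
  have hinv : (2 / s) ^ Module.finrank ℝ V = ((n : ℝ) ^ 2)⁻¹ := by
    rw [hs', ← inv_pow, inv_div]
  have hn0 : (0 : ℝ) < (n : ℝ) ^ 2 := by positivity
  constructor
  · intro hkn
    have hkn : k = n := by exact_mod_cast hkn
    subst hkn
    refine (pow_left_inj₀ (by positivity) (by positivity) hm).1 ?_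
    rw [hinv]
    field_simp
    linarith
  · intro hc2
    rw [hc2, hinv] at hk2
    have : (k : ℝ) ^ 2 = (n : ℝ) ^ 2 := by
      field_simp at hk2
      exact hk2
    rw [sq_eq_sq₀ (by positivity) (by positivity)] at this
    exact_mod_cast this

/-- The inverse of the similarity `S` serves as `T`: from `S L ⊆ L` follows `L = T (S L) ⊆ T L`. -/
theorem exists_latticeCode (h : HasTightSublattice L s n) :
    ∃ C : Set (V ⧸ L), IsLatticeCode L C ∧ C.encard = n := by
  obtain ⟨S, hS, hSL⟩ := h.similar
  have hs := h.two_lt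
  set a := √(s / 2) with ha
  have ha0 : 0 < a := Real.sqrt_pos.2 (by linarith)
  have ha2 : a ^ 2 = s / 2 := Real.sq_sqrt (by linarith)
  let li : V →ₗᵢ[ℝ] V := ⟨a⁻¹ • S, fun x => by
    rw [← sq_eq_sq₀ (norm_nonneg _) (norm_nonneg _), LinearMap.smul_apply, norm_smul, mul_pow, hS,
      Real.norm_of_nonneg (by positivity), inv_pow, ha2]
    have : s ≠ 0 := by linarith
    field_simp⟩
  let e : V ≃ₗᵢ[ℝ] V := li.toLinearIsometryEquiv rfl
  have he : ∀ x, e x = a⁻¹ • S x := fun x => rfl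
  let T : V →ₗ[ℝ] V := a⁻¹ • (e.symm.toLinearEquiv : V →ₗ[ℝ] V)
  have hT : ∀ x, T x = a⁻¹ • e.symm x := fun x => rfl
  have hTS : ∀ x, T (S x) = x := fun x => by
    have : S x = a • e x := by rw [he, smul_inv_smul₀ ha0.ne']
    rw [this, map_smul, hT, e.symm_apply_apply, smul_inv_smul₀ ha0.ne']
  have hLT : L ≤ L.map T.toAddMonoidHom := fun v hv => ⟨S v, hSL v hv, hTS v⟩
  refine ⟨_, ⟨T, ⟨a⁻¹, by positivity, e.symm, hT⟩, hLT, rfl⟩, ?_⟩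
  rw [h.encard_latticeCode_iff (by positivity) e.symm hT hLT, inv_pow, ha2, inv_div]

/-- It suffices to move every code containing `0` with distances at least the covering radius into
the given lattice code. -/
theorem latticeCodeUniquelyOptimal (h : HasTightSublattice L s n)
    (hmove : ∀ T : V →ₗ[ℝ] V, IsConformalOrthogonal T → (∀ x, ‖T x‖ ^ 2 = 2 / s * ‖x‖ ^ 2) →
      L ≤ L.map T.toAddMonoidHom →
      ((fun x : V => (x : V ⧸ L)) '' (L.map T.toAddMonoidHom : Set V)).encard = n →
      ∀ D : Set (V ⧸ L), D.Finite → 0 ∈ D →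
        (∀ x ∈ D, ∀ y ∈ D, x ≠ y → √(4 / s) ≤ ‖x - y‖) →
        ∃ φ : (V ⧸ L) ≃ᵢ (V ⧸ L),
          φ '' D ⊆ (fun x : V => (x : V ⧸ L)) '' (L.map T.toAddMonoidHom : Set V)) :
    LatticeCodeUniquelyOptimal L n := by
  refine ⟨h.exists_latticeCode, ?_⟩
  rintro C ⟨T, hconf, hLT, rfl⟩ hcard
  obtain ⟨c, hc, Q, hTQ⟩ := id hconf
  have hc2 := (h.encard_latticeCode_iff hc Q hTQ hLT).1 hcard
  have hT : ∀ x, ‖T x‖ ^ 2 = 2 / s * ‖x‖ ^ 2 := fun x => by rw [norm_sq_apply Q hTQ, hc2]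
  set C : Set (V ⧸ L) := (fun x : V => (x : V ⧸ L)) '' (L.map T.toAddMonoidHom : Set V) with hC
  have hn2 := h.two_le
  have hsep : ENNReal.ofReal √(4 / s) ≤ C.einfsep := by
    refine Set.le_einfsep ?_
    rintro _ ⟨x, hx, rfl⟩ _ ⟨y, hy, rfl⟩ hxy
    rw [edist_dist, dist_eq_norm]
    refine ENNReal.ofReal_le_ofReal ?_
    exact h.le_norm_of_mem_code hT hLT (x := x - y) (sub_mem hx hy) (sub_ne_zero.2 hxy)
  -- Translation is an isometry of `V ⧸ L`, so a nonempty code may be assumed to contain 0.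
  have hmove' : ∀ D : Set (V ⧸ L), D.Finite → D.Nonempty → ENNReal.ofReal √(4 / s) ≤ D.einfsep →
      ∃ φ : (V ⧸ L) ≃ᵢ (V ⧸ L), φ '' D ⊆ C := by
    rintro D hfin ⟨a, ha⟩ hD
    obtain ⟨φ, hφ⟩ := hmove T hconf hT hLT hcard ((fun x => x - a) '' D) (hfin.image _)
      ⟨a, ha, sub_self a⟩ (by
        rintro _ ⟨x, hx, rfl⟩ _ ⟨y, hy, rfl⟩ hxy
        have hxy' : x ≠ y := fun e => hxy (by rw [e])
        have := Set.le_edist_of_le_einfsep hx hy hxy' hD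
        rw [edist_dist, dist_eq_norm, ENNReal.ofReal_le_ofReal_iff (norm_nonneg _)] at this
        simpa using this)
    refine ⟨(IsometryEquiv.subRight a).trans φ, ?_⟩
    rw [← Set.image_comp] at hφ
    exact hφ
  refine ⟨⟨hcard, fun C' hC' => ?_⟩, ?_, ?_⟩
  · have hnt : C'.Nontrivial := by
      rw [← Set.one_lt_encard_iff_nontrivial, hC']
      exact_mod_cast hn2
    obtain ⟨x, hx, y, hy, hxy⟩ := hnt
    refine (Set.einfsep_le_edist_of_mem hx hy hxy).trans (le_trans ?_ hsep)
    rw [edist_dist, dist_eq_norm]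
    exact ENNReal.ofReal_le_ofReal (h.norm_quotient_le _)
  · rintro D ⟨hD, hopt⟩
    have hfin := Set.finite_of_encard_eq_coe hD
    have hne : D.Nonempty := by
      rw [← Set.encard_pos, hD]
      exact_mod_cast (by omega : 0 < n)
    obtain ⟨φ, hφ⟩ := hmove' D hfin hne (hsep.trans (hopt C hcard))
    refine ⟨φ, (hfin.image φ).eq_of_subset_of_encard_le hφ ?_⟩
    rw [φ.injective.encard_image, hD, hcard]
  · rintro D ⟨hD, hopt⟩
    have hfin := Set.finite_of_encard_eq_coe hD
    have hne : D.Nonempty := by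
      rw [← Set.encard_pos, hD]
      exact_mod_cast (by omega : 0 < n - 1)
    -- Removing a point from `C` does not decrease its separation, so an optimal code of size `n -
    -- 1` is at least as separated as `C`.
    obtain ⟨C', hC'C, hC'⟩ := Set.exists_subset_encard_eq (s := C) (k := ((n - 1 : ℕ) : ℕ∞))
      (by rw [hcard]; exact_mod_cast Nat.sub_le n 1)
    exact hmove' D hfin hne ((hsep.trans (Set.einfsep_anti hC'C)).trans (hopt C' hC'))

/-- Lattice codes are forced when there are few points at maximal distance from `0`. -/
theorem latticeCodeUniquelyOptimal_of_few_holes (h : HasTightSublattice L s n)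
    (H : Set (V ⧸ L)) (hH : H.encard ≤ n)
    (hmem : ∀ x : V, (∀ v ∈ L, 4 / s ≤ ‖x - v‖ ^ 2) → (x : V ⧸ L) ∈ H) (h0 : (0 : V ⧸ L) ∈ H) :
    LatticeCodeUniquelyOptimal L n := by
  have hmem' : ∀ x : V ⧸ L, (x ≠ 0 → √(4 / s) ≤ ‖x‖) → x ∈ H := by
    intro x hx
    by_cases hx0 : x = 0
    · rwa [hx0]
    · replace hx := hx hx0
      induction x using QuotientAddGroup.induction_on with
      | H x => exact hmem x fun v hv => (Real.sqrt_le_iff.1 (le_norm_mk_iff.1 hx v hv)).2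
  refine h.latticeCodeUniquelyOptimal fun T _ hT hLT hcard D _ h0D hD => ⟨IsometryEquiv.refl _, ?_⟩
  -- The code lies in `H` and has at least as many points, so it is all of `H`.
  have hCH : (fun x : V => (x : V ⧸ L)) '' (L.map T.toAddMonoidHom : Set V) = H := by
    refine (Set.finite_of_encard_eq_coe hcard).eq_of_subset_of_encard_le ?_ (by rwa [hcard])
    rintro _ ⟨x, hx, rfl⟩
    exact hmem' _ fun hne => h.le_norm_of_mem_code hT hLT hx hne
  rw [hCH]
  rintro _ ⟨x, hx, rfl⟩
  exact hmem' x fun hne => by simpa using hD x hx 0 h0D hne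

end HasTightSublattice

end SimilarSublattice

/-! ### Reduction to the Voronoi cell. -/

section Reduced

variable {V : Type*} [NormedAddCommGroup V] [InnerProductSpace ℝ V] [FiniteDimensional ℝ V]

/-- Every point of `V` is congruent modulo `L` to a point of the Voronoi cell of `0`. -/
theorem exists_two_mul_inner_le (L : AddSubgroup V) [DiscreteTopology L] (x : V) :
    ∃ v ∈ L, ∀ w ∈ L, 2 * inner ℝ (x - v) w ≤ ‖w‖ ^ 2 := by
  obtain ⟨v, hv, hmin⟩ := exists_forall_norm_sub_le L x
  refine ⟨v, hv, fun w hw => ?_⟩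
  have h1 := hmin (v + w) (add_mem hv hw)
  rw [← sq_le_sq₀ (norm_nonneg _) (norm_nonneg _), ← sub_sub, norm_sub_sq_real (x - v) w] at h1
  linarith

theorem HasTightSublattice.latticeCodeUniquelyOptimal_of_few_reduced_holes {L : AddSubgroup V}
    {s : ℝ} {n : ℕ} (h : HasTightSublattice L s n) (H : Set (V ⧸ L)) (hH : H.encard ≤ n)
    (h0 : (0 : V ⧸ L) ∈ H)
    (hmem : ∀ y : V, (∀ w ∈ L, 2 * inner ℝ y w ≤ ‖w‖ ^ 2) → 4 / s ≤ ‖y‖ ^ 2 → (y : V ⧸ L) ∈ H) :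
    LatticeCodeUniquelyOptimal L n := by
  have := h.discreteTopology
  refine h.latticeCodeUniquelyOptimal_of_few_holes H hH (fun x hx => ?_) h0
  obtain ⟨v, hv, hred⟩ := exists_two_mul_inner_le L x
  have := hmem (x - v) hred (hx v hv)
  rwa [QuotientAddGroup.mk_sub, (QuotientAddGroup.eq_zero_iff v).2 hv, sub_zero] at this

end Reduced

theorem Set.encard_pair_le {α : Type*} (a b : α) : ({a, b} : Set α).encard ≤ 2 := by
  refine (Set.encard_insert_le _ _).trans ?_
  rw [Set.encard_singleton, one_add_one_eq_two]

theorem Set.encard_triple_le {α : Type*} (a b c : α) : ({a, b, c} : Set α).encard ≤ 3 := by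
  refine (Set.encard_insert_le _ _).trans ?_
  calc _ ≤ (2 : ℕ∞) + 1 := by gcongr; exact Set.encard_pair_le _ _
    _ = 3 := by norm_num

theorem Set.encard_quadruple_le {α : Type*} (a b c d : α) :
    ({a, b, c, d} : Set α).encard ≤ 4 := by
  refine (Set.encard_insert_le _ _).trans ?_
  calc _ ≤ (3 : ℕ∞) + 1 := by gcongr; exact Set.encard_triple_le _ _ _
    _ = 4 := by norm_num

theorem EuclideanSpace.real_inner_eq_sum {ι : Type*} [Fintype ι] (x y : EuclideanSpace ℝ ι) :
    inner ℝ x y = ∑ i, x i * y i := by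
  simp [PiLp.inner_apply, mul_comm]

/-! ### Coordinates on the hyperplane of sum zero. -/

section SumZero

theorem mem_sumZero_iff {n : ℕ} {x : EuclideanSpace ℝ (Fin (n + 1))} :
    x ∈ SumZero n ↔ ∑ i, x i = 0 := by
  rw [Submodule.mem_orthogonal_singleton_iff_inner_right, EuclideanSpace.real_inner_eq_sum]
  simp

theorem finrank_sumZero (n : ℕ) : Module.finrank ℝ (SumZero n) = n := by
  have : Fact (Module.finrank ℝ (EuclideanSpace ℝ (Fin (n + 1))) = n + 1) := ⟨by simp⟩
  refine Submodule.finrank_orthogonal_span_singleton (fun h => ?_)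
  simpa using congrArg (fun x : EuclideanSpace ℝ (Fin (n + 1)) => x 0) h

theorem SumZero.norm_sq_eq {n : ℕ} (x : SumZero n) :
    ‖x‖ ^ 2 = ∑ i, (x : EuclideanSpace ℝ (Fin (n + 1))) i ^ 2 :=
  EuclideanSpace.real_norm_sq_eq (x : EuclideanSpace ℝ (Fin (n + 1)))

theorem SumZero.inner_eq {n : ℕ} (x y : SumZero n) :
    inner ℝ x y = ∑ i, (x : EuclideanSpace ℝ (Fin (n + 1))) i *
      (y : EuclideanSpace ℝ (Fin (n + 1))) i :=
  EuclideanSpace.real_inner_eq_sum (x : EuclideanSpace ℝ (Fin (n + 1))) y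

end SumZero

/-! ### The lattice `A₁`. -/

section AOne

/-- The point `(t, -t)` of the line `SumZero 1`. -/
noncomputable def sumZeroOne (t : ℝ) : SumZero 1 :=
  ⟨!₂[t, -t], mem_sumZero_iff.2 (by simp)⟩

theorem norm_sq_sumZeroOne (t : ℝ) : ‖sumZeroOne t‖ ^ 2 = 2 * t ^ 2 := by
  rw [SumZero.norm_sq_eq]
  simp [sumZeroOne]
  ring

theorem inner_sumZeroOne (t u : ℝ) : inner ℝ (sumZeroOne t) (sumZeroOne u) = 2 * (t * u) := by
  rw [SumZero.inner_eq]
  simp [sumZeroOne]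
  ring

theorem sumZeroOne_surjective : Function.Surjective sumZeroOne := by
  rintro ⟨x, hx⟩
  refine ⟨x 0, Subtype.ext ?_⟩
  have := mem_sumZero_iff.1 hx
  rw [Fin.sum_univ_two] at this
  ext i
  fin_cases i
  · rfl
  · exact (eq_neg_of_add_eq_zero_right this).symm

theorem sumZeroOne_mem_iff {t : ℝ} : sumZeroOne t ∈ latticeA 1 ↔ ∃ k : ℤ, t = k := by
  constructor
  · exact fun h => h 0
  · rintro ⟨k, rfl⟩ i
    fin_cases i
    · exact ⟨k, rfl⟩
    · exact ⟨-k, by simp [sumZeroOne]⟩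

theorem sumZeroOne_sub (t u : ℝ) : sumZeroOne t - sumZeroOne u = sumZeroOne (t - u) := by
  refine Subtype.ext ?_
  ext i
  fin_cases i
  · rfl
  · simp [sumZeroOne]
    ring

/-- The squared norms are `2 * k ^ 2`, hence `s = 8`; doubling is the similarity, and rounding gives
the covering bound `1 / 2`. -/
theorem hasTightSublattice_latticeA_one : HasTightSublattice (latticeA 1) 8 2 where
  two_lt := by norm_num
  two_le := le_rfl
  sq_card := by
    rw [finrank_sumZero]
    norm_num
  exists_norm_sq_eq_two := ⟨sumZeroOne 1, sumZeroOne_mem_iff.2 ⟨1, by simp⟩, by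
    rw [norm_sq_sumZeroOne]; norm_num⟩
  exists_norm_sq_eq := ⟨sumZeroOne 2, sumZeroOne_mem_iff.2 ⟨2, by simp⟩, by
    rw [norm_sq_sumZeroOne]; norm_num⟩
  norm_sq_gap := by
    intro v hv hne
    obtain ⟨t, rfl⟩ := sumZeroOne_surjective v
    obtain ⟨k, rfl⟩ := sumZeroOne_mem_iff.1 hv
    have hk : k ≠ 0 := by
      rintro rfl
      apply hne
      rw [← norm_eq_zero, ← sq_eq_zero_iff, norm_sq_sumZeroOne]
      simp
    rw [norm_sq_sumZeroOne]
    have : k ^ 2 = 1 ∨ 4 ≤ k ^ 2 := by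
      rcases eq_or_ne (|k|) 1 with h1 | h1
      · left
        rw [← sq_abs, h1, one_pow]
      · right
        have := abs_pos.2 hk
        rw [← sq_abs]
        nlinarith [show 2 ≤ |k| by omega]
    rcases this with h | h
    · left
      have : (k : ℝ) ^ 2 = 1 := by exact_mod_cast h
      rw [this, mul_one]
    · right
      have : (4 : ℝ) ≤ (k : ℝ) ^ 2 := by exact_mod_cast h
      linarith
  cover := by
    intro x
    obtain ⟨t, rfl⟩ := sumZeroOne_surjective x
    refine ⟨sumZeroOne (round t), sumZeroOne_mem_iff.2 ⟨_, rfl⟩, ?_⟩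
    rw [sumZeroOne_sub, norm_sq_sumZeroOne]
    have := abs_sub_round t
    have := sq_le_sq' (by linarith [abs_nonneg (t - round t)]) this
    rw [sq_abs] at this
    linarith
  similar := by
    refine ⟨(2 : ℝ) • LinearMap.id, fun x => ?_, fun v hv => ?_⟩
    · rw [LinearMap.smul_apply, norm_smul, mul_pow]
      norm_num
    · rw [LinearMap.smul_apply, two_smul]
      exact add_mem hv hv

theorem latticeCodeUniquelyOptimal_latticeA_one :
    LatticeCodeUniquelyOptimal (latticeA 1) 2 := by
  refine hasTightSublattice_latticeA_one.latticeCodeUniquelyOptimal_of_few_reduced_holes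
    {0, ((sumZeroOne (1 / 2) : SumZero 1) : SumZero 1 ⧸ latticeA 1)} (Set.encard_pair_le _ _)
    (by simp) fun y hy h => ?_
  obtain ⟨t, rfl⟩ := sumZeroOne_surjective y
  have h1 := hy (sumZeroOne 1) (sumZeroOne_mem_iff.2 ⟨1, by simp⟩)
  have h2 := hy (sumZeroOne (-1)) (sumZeroOne_mem_iff.2 ⟨-1, by simp⟩)
  rw [inner_sumZeroOne, norm_sq_sumZeroOne] at h1 h2
  rw [norm_sq_sumZeroOne] at h
  have h3 : t = 1 / 2 ∨ t = -1 / 2 := by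
    rcases le_or_gt 0 t with ht | ht
    · left
      nlinarith
    · right
      nlinarith
  right
  rw [Set.mem_singleton_iff, QuotientAddGroup.eq_iff_sub_mem, sumZeroOne_sub, sumZeroOne_mem_iff]
  rcases h3 with rfl | rfl
  · exact ⟨0, by norm_num⟩
  · exact ⟨-1, by norm_num⟩

end AOne

/-! ### The hexagonal lattice `A₂`. -/

section ATwo

/-- The point `(a, b, -a-b)` of the plane `SumZero 2`. -/
noncomputable def sumZeroTwo (a b : ℝ) : SumZero 2 :=
  ⟨!₂[a, b, -a - b], mem_sumZero_iff.2 (by simp [Fin.sum_univ_three])⟩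

theorem norm_sq_sumZeroTwo (a b : ℝ) :
    ‖sumZeroTwo a b‖ ^ 2 = 2 * (a ^ 2 + a * b + b ^ 2) := by
  rw [SumZero.norm_sq_eq]
  simp [sumZeroTwo, Fin.sum_univ_three]
  ring

theorem inner_sumZeroTwo (a b c d : ℝ) : inner ℝ (sumZeroTwo a b) (sumZeroTwo c d) =
    2 * (a * c + b * d) + a * d + b * c := by
  rw [SumZero.inner_eq]
  simp [sumZeroTwo, Fin.sum_univ_three]
  ring

theorem sumZeroTwo_surjective (x : SumZero 2) : ∃ a b, sumZeroTwo a b = x := by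
  obtain ⟨x, hx⟩ := x
  refine ⟨x 0, x 1, Subtype.ext ?_⟩
  have := mem_sumZero_iff.1 hx
  rw [Fin.sum_univ_three] at this
  ext i
  fin_cases i
  · rfl
  · rfl
  · change -x 0 - x 1 = x 2
    linarith

theorem sumZeroTwo_mem_iff {a b : ℝ} :
    sumZeroTwo a b ∈ latticeA 2 ↔ (∃ k : ℤ, a = k) ∧ ∃ l : ℤ, b = l := by
  constructor
  · exact fun h => ⟨h 0, h 1⟩
  · rintro ⟨⟨k, rfl⟩, l, rfl⟩ i
    fin_cases i
    · exact ⟨k, rfl⟩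
    · exact ⟨l, rfl⟩
    · exact ⟨-k - l, by simp [sumZeroTwo]⟩

theorem sumZeroTwo_sub (a b c d : ℝ) :
    sumZeroTwo a b - sumZeroTwo c d = sumZeroTwo (a - c) (b - d) := by
  refine Subtype.ext ?_
  ext i
  fin_cases i
  · rfl
  · rfl
  · simp [sumZeroTwo]
    ring

theorem sumZeroTwo_add (a b c d : ℝ) :
    sumZeroTwo a b + sumZeroTwo c d = sumZeroTwo (a + c) (b + d) := by
  refine Subtype.ext ?_
  ext i
  fin_cases i
  · rfl
  · rfl
  · simp [sumZeroTwo]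
    ring

theorem smul_sumZeroTwo (r a b : ℝ) : r • sumZeroTwo a b = sumZeroTwo (r * a) (r * b) := by
  refine Subtype.ext ?_
  ext i
  fin_cases i
  · rfl
  · rfl
  · simp [sumZeroTwo]
    ring

/-- The rotation of the plane `SumZero 2` by a right angle, scaled by `√3`. -/
noncomputable def sumZeroTwoRotation : SumZero 2 →ₗ[ℝ] SumZero 2 where
  toFun x := sumZeroTwo ((x : EuclideanSpace ℝ (Fin 3)) 0 + 2 * (x : EuclideanSpace ℝ (Fin 3)) 1)
    (-2 * (x : EuclideanSpace ℝ (Fin 3)) 0 - (x : EuclideanSpace ℝ (Fin 3)) 1)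
  map_add' x y := by
    rw [sumZeroTwo_add]
    congr 1 <;> simp <;> ring
  map_smul' r x := by
    rw [RingHom.id_apply, smul_sumZeroTwo]
    congr 1 <;> simp <;> ring

theorem sumZeroTwoRotation_apply (a b : ℝ) :
    sumZeroTwoRotation (sumZeroTwo a b) = sumZeroTwo (a + 2 * b) (-2 * a - b) := rfl

/-- A point of the Voronoi cell of `0` in the hexagonal lattice. -/
theorem sumZeroTwo_reduced_bounds {a b : ℝ}
    (h : ∀ w ∈ latticeA 2, 2 * inner ℝ (sumZeroTwo a b) w ≤ ‖w‖ ^ 2) :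
    |a - b| ≤ 1 ∧ |a + 2 * b| ≤ 1 ∧ |2 * a + b| ≤ 1 := by
  have key : ∀ k l : ℤ, 2 * (2 * (a * k + b * l) + a * l + b * k) ≤
      2 * (k ^ 2 + k * l + l ^ 2) := fun k l => by
    have := h (sumZeroTwo k l) (sumZeroTwo_mem_iff.2 ⟨⟨k, rfl⟩, l, rfl⟩)
    rwa [inner_sumZeroTwo, norm_sq_sumZeroTwo] at this
  have h1 := key 1 (-1)
  have h2 := key (-1) 1
  have h3 := key 0 1
  have h4 := key 0 (-1)
  have h5 := key 1 0
  have h6 := key (-1) 0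
  push_cast at h1 h2 h3 h4 h5 h6
  refine ⟨abs_le.2 ⟨?_, ?_⟩, abs_le.2 ⟨?_, ?_⟩, abs_le.2 ⟨?_, ?_⟩⟩ <;> linarith

/-- The form is even only when `k` and `l` both are, and is then divisible by 4; so it never equals
2. -/
theorem Int.sq_add_mul_add_sq_eq_one_or {k l : ℤ} (h : 0 < k ^ 2 + k * l + l ^ 2) :
    k ^ 2 + k * l + l ^ 2 = 1 ∨ 3 ≤ k ^ 2 + k * l + l ^ 2 := by
  by_contra! hc
  have h2 : k ^ 2 + k * l + l ^ 2 = 2 := by omega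
  rcases Int.even_or_odd' k with ⟨a, rfl | rfl⟩ <;> rcases Int.even_or_odd' l with ⟨b, rfl | rfl⟩ <;>
    ring_nf at h2 <;> omega

theorem norm_sq_gap_latticeA_two {v : SumZero 2} (hv : v ∈ latticeA 2) (hne : v ≠ 0) :
    ‖v‖ ^ 2 = 2 ∨ 6 ≤ ‖v‖ ^ 2 := by
  obtain ⟨a, b, rfl⟩ := sumZeroTwo_surjective v
  obtain ⟨⟨k, rfl⟩, l, rfl⟩ := sumZeroTwo_mem_iff.1 hv
  have hpos : 0 < ‖sumZeroTwo k l‖ ^ 2 := by positivity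
  rw [norm_sq_sumZeroTwo] at hpos ⊢
  have hpos' : 0 < k ^ 2 + k * l + l ^ 2 := by
    have : (0 : ℝ) < k ^ 2 + k * l + l ^ 2 := by linarith
    exact_mod_cast this
  rcases Int.sq_add_mul_add_sq_eq_one_or hpos' with h | h
  · left
    have : (k : ℝ) ^ 2 + k * l + l ^ 2 = 1 := by exact_mod_cast h
    rw [this, mul_one]
  · right
    have : (3 : ℝ) ≤ (k : ℝ) ^ 2 + k * l + l ^ 2 := by exact_mod_cast h
    linarith

/-- The three linear forms are inner products with roots, the third being the sum of the other two.
The two products add up to `2 - 3 * ‖y‖ ^ 2` for `y = sumZeroTwo a b`, which gives the covering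
bound `2 / 3`. -/
theorem sumZeroTwo_reduced_products {a b : ℝ} (h1 : |a - b| ≤ 1) (h2 : |a + 2 * b| ≤ 1)
    (h3 : |2 * a + b| ≤ 1) :
    0 ≤ (1 - (a - b)) * (1 - (a + 2 * b)) * (1 + (2 * a + b)) ∧
      0 ≤ (1 + (a - b)) * (1 + (a + 2 * b)) * (1 - (2 * a + b)) := by
  rw [abs_le] at h1 h2 h3
  exact ⟨mul_nonneg (mul_nonneg (by linarith) (by linarith)) (by linarith),
    mul_nonneg (mul_nonneg (by linarith) (by linarith)) (by linarith)⟩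

theorem hasTightSublattice_latticeA_two : HasTightSublattice (latticeA 2) 6 3 where
  two_lt := by norm_num
  two_le := by norm_num
  sq_card := by
    rw [finrank_sumZero]
    norm_num
  exists_norm_sq_eq_two := ⟨sumZeroTwo 1 0, sumZeroTwo_mem_iff.2 ⟨⟨1, by simp⟩, 0, by simp⟩, by
    rw [norm_sq_sumZeroTwo]; norm_num⟩
  exists_norm_sq_eq := ⟨sumZeroTwo 1 1, sumZeroTwo_mem_iff.2 ⟨⟨1, by simp⟩, 1, by simp⟩, by
    rw [norm_sq_sumZeroTwo]; norm_num⟩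
  norm_sq_gap := fun _ => norm_sq_gap_latticeA_two
  cover := by
    intro x
    have : DiscreteTopology (latticeA 2) := discreteTopology_of_le_norm_sq two_pos
      fun v hv hne => by rcases norm_sq_gap_latticeA_two hv hne with h | h <;> linarith
    obtain ⟨v, hv, hred⟩ := exists_two_mul_inner_le (latticeA 2) x
    refine ⟨v, hv, ?_⟩
    obtain ⟨a, b, hab⟩ := sumZeroTwo_surjective (x - v)
    rw [← hab] at hred ⊢
    obtain ⟨h1, h2, h3⟩ := sumZeroTwo_reduced_bounds hred
    obtain ⟨g1, g2⟩ := sumZeroTwo_reduced_products h1 h2 h3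
    rw [norm_sq_sumZeroTwo]
    nlinarith
  similar := by
    refine ⟨sumZeroTwoRotation, fun x => ?_, fun v hv => ?_⟩
    · obtain ⟨a, b, rfl⟩ := sumZeroTwo_surjective x
      rw [sumZeroTwoRotation_apply, norm_sq_sumZeroTwo, norm_sq_sumZeroTwo]
      ring
    · obtain ⟨a, b, rfl⟩ := sumZeroTwo_surjective v
      obtain ⟨⟨k, rfl⟩, l, rfl⟩ := sumZeroTwo_mem_iff.1 hv
      rw [sumZeroTwoRotation_apply]
      exact sumZeroTwo_mem_iff.2 ⟨⟨k + 2 * l, by push_cast; ring⟩, -2 * k - l, by push_cast; ring⟩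

/-- The deep holes of the hexagonal lattice. -/
theorem eq_of_reduced_hole {a b : ℝ} (h1 : |a - b| ≤ 1) (h2 : |a + 2 * b| ≤ 1)
    (h3 : |2 * a + b| ≤ 1) (h : 4 / 6 ≤ 2 * (a ^ 2 + a * b + b ^ 2)) :
    (∃ k l : ℤ, a = 1 / 3 + k ∧ b = 1 / 3 + l) ∨ ∃ k l : ℤ, a = -1 / 3 + k ∧ b = -1 / 3 + l := by
  obtain ⟨g1, g2⟩ := sumZeroTwo_reduced_products h1 h2 h3
  -- At a deep hole the two nonnegative products have sum at most 0, so both vanish.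
  have e1 : (1 - (a - b)) * (1 - (a + 2 * b)) * (1 + (2 * a + b)) = 0 := by nlinarith
  have e2 : (1 + (a - b)) * (1 + (a + 2 * b)) * (1 - (2 * a + b)) = 0 := by nlinarith
  simp only [mul_eq_zero, or_assoc] at e1 e2
  -- Three of the nine cases are contradictory; the other six are the vertices of the hexagonal
  -- cell, three in each class modulo `A₂`.
  rcases e1 with e1 | e1 | e1 <;> rcases e2 with e2 | e2 | e2
  · linarith
  · exact Or.inl ⟨0, -1, by push_cast; linarith, by push_cast; linarith⟩
  · exact Or.inr ⟨1, 0, by push_cast; linarith, by push_cast; linarith⟩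
  · exact Or.inr ⟨0, 1, by push_cast; linarith, by push_cast; linarith⟩
  · linarith
  · exact Or.inl ⟨0, 0, by push_cast; linarith, by push_cast; linarith⟩
  · exact Or.inl ⟨-1, 0, by push_cast; linarith, by push_cast; linarith⟩
  · exact Or.inr ⟨0, 0, by push_cast; linarith, by push_cast; linarith⟩
  · linarith

theorem latticeCodeUniquelyOptimal_latticeA_two :
    LatticeCodeUniquelyOptimal (latticeA 2) 3 := by
  refine hasTightSublattice_latticeA_two.latticeCodeUniquelyOptimal_of_few_reduced_holes
    {0, ((sumZeroTwo (1 / 3) (1 / 3) : SumZero 2) : SumZero 2 ⧸ latticeA 2),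
      ((sumZeroTwo (-1 / 3) (-1 / 3) : SumZero 2) : SumZero 2 ⧸ latticeA 2)}
    (Set.encard_triple_le _ _ _) (by simp) fun y hy h => ?_
  obtain ⟨a, b, rfl⟩ := sumZeroTwo_surjective y
  obtain ⟨h1, h2, h3⟩ := sumZeroTwo_reduced_bounds hy
  rw [norm_sq_sumZeroTwo] at h
  right
  rcases eq_of_reduced_hole h1 h2 h3 h with ⟨k, l, rfl, rfl⟩ | ⟨k, l, rfl, rfl⟩
  · left
    rw [QuotientAddGroup.eq_iff_sub_mem, sumZeroTwo_sub, sumZeroTwo_mem_iff]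
    exact ⟨⟨k, by ring⟩, l, by ring⟩
  · right
    rw [Set.mem_singleton_iff, QuotientAddGroup.eq_iff_sub_mem, sumZeroTwo_sub, sumZeroTwo_mem_iff]
    exact ⟨⟨k, by ring⟩, l, by ring⟩

end ATwo

/-! ### Norms in `D_n` and reduction against its roots. -/

section RootLattice

theorem exists_sign_mul_eq_abs (t : ℝ) : ∃ a : ℤ, a ^ 2 = 1 ∧ a * t = |t| := by
  rcases le_total 0 t with h | h
  · exact ⟨1, one_pow 2, by simp [abs_of_nonneg h]⟩
  · exact ⟨-1, by norm_num, by simp [abs_of_nonpos h]⟩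

theorem Int.even_sub_sq (a : ℤ) : Even (a ^ 2 - a) := by
  rw [show a ^ 2 - a = (a - 1) * (a - 1 + 1) by ring]
  exact Int.even_mul_succ_self _

variable {n : ℕ}

theorem toLp_mem_latticeD {k : Fin n → ℤ} (h : Even (∑ i, k i)) :
    WithLp.toLp 2 (fun i => (k i : ℝ)) ∈ latticeD n := by
  refine ⟨fun i => ⟨k i, rfl⟩, ?_⟩
  obtain ⟨s, hs⟩ := h
  refine ⟨s, ?_⟩
  change ∑ i, (k i : ℝ) = _
  rw [← Int.cast_sum, hs]
  push_cast
  ring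

theorem mem_latticeD_iff {x : EuclideanSpace ℝ (Fin n)} :
    x ∈ latticeD n ↔ ∃ k : Fin n → ℤ, (∀ i, x i = k i) ∧ Even (∑ i, k i) := by
  constructor
  · rintro ⟨h, s, hs⟩
    choose k hk using h
    refine ⟨k, hk, s, ?_⟩
    simp_rw [hk] at hs
    rw [← two_mul]
    exact_mod_cast hs
  · rintro ⟨k, hk, hev⟩
    convert! toLp_mem_latticeD hev using 1
    ext i
    exact hk i

/-- Since `k ^ 2` and `k` have the same parity, the sum of squares is even along with the coordinate
sum. -/
theorem exists_norm_sq_eq_two_mul_of_mem_latticeD {v : EuclideanSpace ℝ (Fin n)}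
    (hv : v ∈ latticeD n) : ∃ j : ℤ, ‖v‖ ^ 2 = 2 * j := by
  obtain ⟨k, hk, hev⟩ := mem_latticeD_iff.1 hv
  have : Even (∑ i, k i ^ 2) := by
    have h : Even (∑ i, (k i ^ 2 - k i)) := Finset.even_sum _ fun i _ => Int.even_sub_sq _
    rw [Finset.sum_sub_distrib] at h
    simpa using h.add hev
  obtain ⟨j, hj⟩ := this
  refine ⟨j, ?_⟩
  rw [EuclideanSpace.real_norm_sq_eq]
  simp_rw [hk]
  rw [two_mul]
  exact_mod_cast hj

theorem norm_sq_eq_two_or_four_le {V : Type*} [NormedAddCommGroup V] {v : V}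
    (h : ∃ j : ℤ, ‖v‖ ^ 2 = 2 * j) (hne : v ≠ 0) : ‖v‖ ^ 2 = 2 ∨ 4 ≤ ‖v‖ ^ 2 := by
  obtain ⟨j, hj⟩ := h
  have hpos : 0 < ‖v‖ ^ 2 := by positivity
  rw [hj] at hpos ⊢
  have hj0 : 0 < j := by
    have : (0 : ℝ) < j := by linarith
    exact_mod_cast this
  rcases (show 1 ≤ j from hj0).eq_or_lt with rfl | h2
  · left
    simp
  · right
    have : (2 : ℝ) ≤ j := by exact_mod_cast h2
    linarith

theorem single_add_single_mem_latticeD (i j : Fin n) {a b : ℤ} (h : Even (a + b)) :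
    EuclideanSpace.single i (a : ℝ) + EuclideanSpace.single j (b : ℝ) ∈ latticeD n := by
  refine mem_latticeD_iff.2 ⟨Pi.single i a + Pi.single j b, fun k => ?_, ?_⟩
  · simp [Pi.single_apply]
  · simpa [Finset.sum_add_distrib] using h

theorem norm_sq_single_add_single {i j : Fin n} (hij : i ≠ j) (a b : ℝ) :
    ‖EuclideanSpace.single i a + EuclideanSpace.single j b‖ ^ 2 = a ^ 2 + b ^ 2 := by
  rw [norm_add_sq_real]
  simp [EuclideanSpace.inner_single_left, hij]

/-- This is the Voronoi inequality for the root `±eᵢ ± eⱼ` whose signs match those of `y`. -/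
theorem abs_add_abs_le_one_of_reduced {L : AddSubgroup (EuclideanSpace ℝ (Fin n))}
    (hL : latticeD n ≤ L) {y : EuclideanSpace ℝ (Fin n)}
    (hy : ∀ w ∈ L, 2 * inner ℝ y w ≤ ‖w‖ ^ 2) {i j : Fin n} (hij : i ≠ j) :
    |y i| + |y j| ≤ 1 := by
  obtain ⟨a, ha, hai⟩ := exists_sign_mul_eq_abs (y i)
  obtain ⟨b, hb, hbj⟩ := exists_sign_mul_eq_abs (y j)
  have hab : Even (a + b) := by
    have h1 := (Int.even_sub_sq a).add (Int.even_sub_sq b)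
    rw [ha, hb, show (1 - a + (1 - b) : ℤ) = 2 - (a + b) by ring] at h1
    exact (Int.even_sub.1 h1).1 even_two
  have := hy _ (hL (single_add_single_mem_latticeD i j hab))
  rw [norm_sq_single_add_single hij, inner_add_right] at this
  simp only [EuclideanSpace.inner_single_right, conj_trivial] at this
  rw [hai, hbj] at this
  have ha' : (a : ℝ) ^ 2 = 1 := by exact_mod_cast ha
  have hb' : (b : ℝ) ^ 2 = 1 := by exact_mod_cast hb
  linarith

end RootLattice

/-! ### The lattice `D₄`. -/

section DFour

/-- If some coordinate `x` exceeds `1 / 2`, the other three are at most `1 - x`, and `x ^ 2 + 3 * (1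
- x) ^ 2 - 1 = 2 * (2 * x - 1) * (x - 1) ≤ 0`. Otherwise each of the four squares is at most `1 /
4`. -/
theorem sum_sq_le_one_of_pairwise {u : Fin 4 → ℝ} (hu : ∀ i, 0 ≤ u i)
    (h : ∀ i j, i ≠ j → u i + u j ≤ 1) :
    ∑ i, u i ^ 2 ≤ 1 ∧ (1 ≤ ∑ i, u i ^ 2 →
      (∀ i, u i = 1 / 2) ∨ ∃ i, u i = 1 ∧ ∀ j, j ≠ i → u j = 0) := by
  by_cases hc : ∃ i, 1 / 2 < u i
  · obtain ⟨i, hi⟩ := hc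
    have hrest : ∑ j ∈ Finset.univ.erase i, u j ^ 2 ≤ 3 * (1 - u i) ^ 2 := by
      refine (Finset.sum_le_card_nsmul _ _ ((1 - u i) ^ 2) fun j hj => ?_).trans (by simp)
      have := h i j (Finset.ne_of_mem_erase hj).symm
      exact pow_le_pow_left₀ (hu j) (by linarith) 2
    have hle : u i ≤ 1 := by
      have := h i (i + 1) (by simp)
      linarith [hu (i + 1)]
    rw [← Finset.add_sum_erase _ _ (Finset.mem_univ i)]
    refine ⟨by nlinarith, fun h1 => Or.inr ⟨i, by nlinarith, fun j hj => ?_⟩⟩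
    have := h i j hj.symm
    have : u i = 1 := by nlinarith
    linarith [hu j]
  · push Not at hc
    have hsq : ∀ i, u i ^ 2 ≤ 1 / 4 := fun i => by nlinarith [hu i, hc i]
    refine ⟨?_, fun h1 => Or.inl fun i => ?_⟩
    · refine (Finset.sum_le_card_nsmul _ _ _ fun i _ => hsq i).trans ?_
      norm_num
    · have hrest : ∑ j ∈ Finset.univ.erase i, u j ^ 2 ≤ 3 * (1 / 4) :=
        (Finset.sum_le_card_nsmul _ _ _ fun j _ => hsq j).trans (by simp)
      rw [← Finset.add_sum_erase _ _ (Finset.mem_univ i)] at h1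
      nlinarith [hu i, hc i]

theorem sum_sq_le_one_of_reduced_latticeD_four {y : EuclideanSpace ℝ (Fin 4)}
    (hy : ∀ w ∈ latticeD 4, 2 * inner ℝ y w ≤ ‖w‖ ^ 2) :
    ‖y‖ ^ 2 ≤ 1 ∧ (1 ≤ ‖y‖ ^ 2 →
      (∀ i, |y i| = 1 / 2) ∨ ∃ i, |y i| = 1 ∧ ∀ j, j ≠ i → y j = 0) := by
  have := sum_sq_le_one_of_pairwise (u := fun i => |y i|) (fun i => abs_nonneg _)
    fun i j hij => abs_add_abs_le_one_of_reduced le_rfl hy hij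
  simpa only [sq_abs, abs_eq_zero, ← EuclideanSpace.real_norm_sq_eq] using this

/-- A similarity of norm `2` that maps `D₄` into itself. -/
noncomputable def butterflyFour : EuclideanSpace ℝ (Fin 4) →ₗ[ℝ] EuclideanSpace ℝ (Fin 4) where
  toFun x := !₂[x 0 + x 1, x 0 - x 1, x 2 + x 3, x 2 - x 3]
  map_add' x y := by
    ext i
    fin_cases i <;> simp <;> ring
  map_smul' r x := by
    ext i
    fin_cases i <;> simp <;> ring

theorem hasTightSublattice_latticeD_four : HasTightSublattice (latticeD 4) 4 4 where
  two_lt := by norm_num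
  two_le := by norm_num
  sq_card := by
    rw [finrank_euclideanSpace]
    norm_num
  exists_norm_sq_eq_two := ⟨_, single_add_single_mem_latticeD 0 1 (a := 1) (b := 1) (by decide), by
    rw [norm_sq_single_add_single (by decide)]
    norm_num⟩
  exists_norm_sq_eq := ⟨_, toLp_mem_latticeD (k := fun _ => 1) (by decide), by
    rw [EuclideanSpace.real_norm_sq_eq]
    simp⟩
  norm_sq_gap v hv := norm_sq_eq_two_or_four_le (exists_norm_sq_eq_two_mul_of_mem_latticeD hv)
  cover := by
    intro x
    have : DiscreteTopology (latticeD 4) := discreteTopology_of_le_norm_sq two_pos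
      fun v hv hne => by
        rcases norm_sq_eq_two_or_four_le (exists_norm_sq_eq_two_mul_of_mem_latticeD hv) hne
          with h | h <;> linarith
    obtain ⟨v, hv, hred⟩ := exists_two_mul_inner_le (latticeD 4) x
    refine ⟨v, hv, ?_⟩
    rw [div_self four_ne_zero]
    exact (sum_sq_le_one_of_reduced_latticeD_four hred).1
  similar := by
    refine ⟨butterflyFour, fun x => ?_, ?_⟩
    · simp only [EuclideanSpace.real_norm_sq_eq, Fin.sum_univ_four, butterflyFour]
      simp
      ring
    · intro v hv
      obtain ⟨k, hk, -⟩ := mem_latticeD_iff.1 hv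
      refine mem_latticeD_iff.2 ⟨![k 0 + k 1, k 0 - k 1, k 2 + k 3, k 2 - k 3], fun i => ?_, ?_⟩
      · fin_cases i <;> simp [butterflyFour, hk]
      · rw [Fin.sum_univ_four]
        exact ⟨k 0 + k 2, by simp; ring⟩

theorem latticeCodeUniquelyOptimal_latticeD_four :
    LatticeCodeUniquelyOptimal (latticeD 4) 4 := by
  refine hasTightSublattice_latticeD_four.latticeCodeUniquelyOptimal_of_few_reduced_holes
    {0, ((EuclideanSpace.single 0 1 : EuclideanSpace ℝ (Fin 4)) : _ ⧸ latticeD 4),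
      ((WithLp.toLp 2 (fun _ => 1 / 2) : EuclideanSpace ℝ (Fin 4)) : _ ⧸ latticeD 4),
      ((WithLp.toLp 2 (fun _ => 1 / 2) - EuclideanSpace.single 0 1 : EuclideanSpace ℝ (Fin 4)) :
        _ ⧸ latticeD 4)}
    (Set.encard_quadruple_le _ _ _ _) (by simp) fun y hy h => ?_
  rw [div_self four_ne_zero] at h
  right
  rcases (sum_sq_le_one_of_reduced_latticeD_four hy).2 h with h | ⟨i, hi, h0⟩
  · right
    have : ∀ i, ∃ k : ℤ, y i = 1 / 2 + k := fun i => by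
      rcases eq_or_eq_neg_of_abs_eq (h i) with hi | hi
      · exact ⟨0, by rw [hi]; norm_num⟩
      · exact ⟨-1, by rw [hi]; norm_num⟩
    choose k hk using this
    -- Points with all coordinates `±1/2` form two classes modulo `D₄`, told apart by this parity.
    rcases Int.even_or_odd (∑ i, k i) with hev | hodd
    · left
      rw [QuotientAddGroup.eq_iff_sub_mem]
      exact mem_latticeD_iff.2 ⟨k, fun i => by simp [hk], hev⟩
    · right
      rw [Set.mem_singleton_iff, QuotientAddGroup.eq_iff_sub_mem]
      refine mem_latticeD_iff.2 ⟨k + Pi.single 0 1, fun i => ?_, ?_⟩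
      · simp [hk, Pi.single_apply]
      · simpa [Finset.sum_add_distrib] using hodd.add_odd odd_one
  · left
    rw [QuotientAddGroup.eq_iff_sub_mem]
    obtain ⟨a, ha, hya⟩ : ∃ a : ℤ, Even (a - 1) ∧ y i = a := by
      rcases eq_or_eq_neg_of_abs_eq hi with hi | hi
      · exact ⟨1, by decide, by rw [hi]; norm_num⟩
      · exact ⟨-1, by decide, by rw [hi]; norm_num⟩
    refine mem_latticeD_iff.2 ⟨Pi.single i a - Pi.single 0 1, fun j => ?_, ?_⟩
    · have : y j = ((Pi.single i a : Fin 4 → ℤ) j : ℝ) := by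
        rcases eq_or_ne j i with rfl | hj
        · simpa using hya
        · simp [h0 j hj, hj]
      simp [this, Pi.single_apply]
    · simpa [Finset.sum_sub_distrib] using ha

end DFour

/-! ### Even self-dual lattices and the reflection argument. -/

section EvenUnimodular

variable {V : Type*} [NormedAddCommGroup V] [InnerProductSpace ℝ V]

theorem intCast_smul_mem {L : AddSubgroup V} {v : V} (hv : v ∈ L) (k : ℤ) : (k : ℝ) • v ∈ L := by
  rw [Int.cast_smul_eq_zsmul]
  exact L.zsmul_mem hv k

theorem exists_inner_eq_intCast {L : AddSubgroup V} (heven : ∀ v ∈ L, ∃ j : ℤ, ‖v‖ ^ 2 = 2 * j)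
    {v w : V} (hv : v ∈ L) (hw : w ∈ L) : ∃ k : ℤ, inner ℝ v w = k := by
  obtain ⟨a, ha⟩ := heven v hv
  obtain ⟨b, hb⟩ := heven w hw
  obtain ⟨c, hc⟩ := heven (v + w) (add_mem hv hw)
  rw [norm_add_sq_real] at hc
  refine ⟨c - a - b, ?_⟩
  push_cast
  linarith

theorem reflection_apply_of_norm_sq_eq_two {r : V} (hr : ‖r‖ ^ 2 = 2) (x : V) :
    (Submodule.span ℝ {r})ᗮ.reflection x = x - inner ℝ r x • r := by
  rw [Submodule.reflection_orthogonal_apply, Submodule.reflection_singleton_apply]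
  simp only [RCLike.ofReal_real_eq_id, id_eq, hr]
  rw [← Nat.cast_smul_eq_nsmul ℝ, smul_smul]
  push_cast
  rw [mul_div_cancel₀ _ two_ne_zero]
  abel

variable [FiniteDimensional ℝ V] {L : AddSubgroup V}

/-- In an even lattice of covering radius `1` whose deep holes are halves of lattice vectors, the
points congruent to a lattice vector or a deep hole are halves of lattice vectors, and have
integral squared norm. -/
theorem two_smul_mem_and_norm_sq_eq_intCast {n : ℕ} (h : HasTightSublattice L 4 n)
    (heven : ∀ v ∈ L, ∃ j : ℤ, ‖v‖ ^ 2 = 2 * j)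
    (hhole : ∀ y : V, (∀ w ∈ L, 2 * inner ℝ y w ≤ ‖w‖ ^ 2) → 1 ≤ ‖y‖ ^ 2 → (2 : ℝ) • y ∈ L)
    {p : V} (hp : (p : V ⧸ L) ≠ 0 → 1 ≤ ‖(p : V ⧸ L)‖) :
    (2 : ℝ) • p ∈ L ∧ ∃ k : ℤ, ‖p‖ ^ 2 = k := by
  by_cases h0 : (p : V ⧸ L) = 0
  · rw [QuotientAddGroup.eq_zero_iff] at h0
    refine ⟨by simpa using intCast_smul_mem h0 2, ?_⟩
    obtain ⟨j, hj⟩ := heven p h0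
    exact ⟨2 * j, by simpa using hj⟩
  · have := h.discreteTopology
    obtain ⟨v, hv, hred⟩ := exists_two_mul_inner_le L p
    have hge : 1 ≤ ‖p - v‖ ^ 2 := one_le_pow₀ (le_norm_mk_iff.1 (hp h0) v hv)
    have h2 := hhole _ hred hge
    -- By the Voronoi inequalities no lattice vector is closer to `p - v` than 0, so the covering
    -- bound holds for 0 itself.
    have hle : ‖p - v‖ ^ 2 ≤ 1 := by
      obtain ⟨w, hw, hle⟩ := h.cover (p - v)
      rw [norm_sub_sq_real, div_self four_ne_zero] at hle
      linarith [hred w hw]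
    obtain ⟨k, hk⟩ := exists_inner_eq_intCast heven h2 hv
    obtain ⟨j, hj⟩ := heven v hv
    constructor
    · have h3 : (2 : ℝ) • v ∈ L := by simpa using intCast_smul_mem hv 2
      have := add_mem h2 h3
      rwa [← smul_add, sub_add_cancel] at this
    · refine ⟨1 + k + 2 * j, ?_⟩
      rw [inner_smul_left] at hk
      simp only [conj_trivial] at hk
      have : ‖p‖ ^ 2 = ‖p - v + v‖ ^ 2 := by rw [sub_add_cancel]
      rw [this, norm_add_sq_real, hk, hj]
      push_cast
      linarith

/-- For `p` in `½L`, `‖p‖ ^ 2` modulo 1 depends only on the class of `p`, with polar form `2 * inner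
ℝ p q`. Reflections in roots preserve `L` and act on the classes as transvections, which bring the
points of `D` into `C` one at a time. -/
theorem latticeCodeUniquelyOptimal_of_even_of_selfDual {n : ℕ} (h : HasTightSublattice L 4 n)
    (heven : ∀ v ∈ L, ∃ j : ℤ, ‖v‖ ^ 2 = 2 * j)
    (hdual : ∀ u : V, (∀ v ∈ L, ∃ k : ℤ, inner ℝ u v = k) → u ∈ L)
    (hhole : ∀ y : V, (∀ w ∈ L, 2 * inner ℝ y w ≤ ‖w‖ ^ 2) → 1 ≤ ‖y‖ ^ 2 → (2 : ℝ) • y ∈ L) :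
    LatticeCodeUniquelyOptimal L n := by
  have hint : ∀ {v w : V}, v ∈ L → w ∈ L → ∃ k : ℤ, inner ℝ v w = k :=
    exists_inner_eq_intCast heven
  refine h.latticeCodeUniquelyOptimal fun T hconf hT hLT _ D hfin h0D hD => ?_
  rw [div_self four_ne_zero, Real.sqrt_one] at hD
  have hdeep : ∀ {p : V}, ((p : V ⧸ L) ≠ 0 → 1 ≤ ‖(p : V ⧸ L)‖) →
      (2 : ℝ) • p ∈ L ∧ ∃ k : ℤ, ‖p‖ ^ 2 = k :=
    two_smul_mem_and_norm_sq_eq_intCast h heven hhole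
  have hpolar : ∀ {p q : V}, (∃ k : ℤ, ‖p‖ ^ 2 = k) → (∃ k : ℤ, ‖q‖ ^ 2 = k) →
      (∃ k : ℤ, ‖p - q‖ ^ 2 = k) → ∃ k : ℤ, 2 * inner ℝ p q = k := by
    rintro p q ⟨a, ha⟩ ⟨b, hb⟩ ⟨c, hc⟩
    rw [norm_sub_sq_real] at hc
    exact ⟨a + b - c, by push_cast; linarith⟩
  set M := L.map T.toAddMonoidHom with hM
  have hMdeep : ∀ {p : V}, p ∈ M → (2 : ℝ) • p ∈ L ∧ ∃ k : ℤ, ‖p‖ ^ 2 = k := fun {p} hp =>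
    hdeep fun hne => by
      have := h.le_norm_of_mem_code hT hLT hp hne
      rwa [div_self four_ne_zero, Real.sqrt_one] at this
  set C : Set (V ⧸ L) := (fun x : V => (x : V ⧸ L)) '' (M : Set V) with hC
  -- `M / L` is a maximal totally singular subspace
  have hmax : ∀ u : V, u ∉ M → ∃ w ∈ M, ∀ k : ℤ, 2 * inner ℝ u w ≠ k := by
    obtain ⟨c, -, Q, hTQ⟩ := hconf
    have hc2 : c ^ 2 = 1 / 2 := by
      obtain ⟨v, -, hv⟩ := h.exists_norm_sq_eq_two
      have := hT v
      rw [HasTightSublattice.norm_sq_apply Q hTQ, hv] at this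
      linarith
    intro u hu
    by_contra! hcon
    -- As `L` is self-dual and `c ^ 2 = 1 / 2`, the dual of `M = TL` is `2M`; the assumption puts
    -- `2u` in this dual, so `u` is in `M`. The witness is the preimage of `u` under `T`.
    refine hu ⟨(2 * c) • Q.symm u, hdual _ fun v hv => ?_, ?_⟩
    · obtain ⟨k, hk⟩ := hcon (T v) ⟨v, hv, rfl⟩
      refine ⟨k, ?_⟩
      rw [← hk, hTQ, inner_smul_left, inner_smul_right, ← Q.inner_map_map, Q.apply_symm_apply]
      simp only [conj_trivial]
      ring
    · change T _ = u
      rw [hTQ, map_smul, Q.apply_symm_apply, smul_smul, show c * (2 * c) = 2 * c ^ 2 by ring, hc2]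
      simp
  induction hm : (D \ C).ncard using Nat.strong_induction_on generalizing D with
  | h m ih =>
  subst hm
  by_cases hDC : D ⊆ C
  · exact ⟨IsometryEquiv.refl _, by
      rintro _ ⟨x, hx, rfl⟩
      exact hDC hx⟩
  obtain ⟨ubar, huD, huC⟩ := Set.not_subset.1 hDC
  obtain ⟨u, rfl⟩ := QuotientAddGroup.mk_surjective ubar
  have huM : u ∉ M := fun hu => huC ⟨u, hu, rfl⟩
  have hDdeep : ∀ {p q : V}, (p : V ⧸ L) ∈ D → (q : V ⧸ L) ∈ D →
      (2 : ℝ) • (p - q) ∈ L ∧ ∃ k : ℤ, ‖p - q‖ ^ 2 = k := fun {p q} hp hq =>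
    hdeep (p := p - q) fun hne => by
      rw [QuotientAddGroup.mk_sub] at hne ⊢
      exact hD _ hp _ hq (sub_ne_zero.1 hne)
  have hDdeep0 : ∀ {p : V}, (p : V ⧸ L) ∈ D → (2 : ℝ) • p ∈ L ∧ ∃ k : ℤ, ‖p‖ ^ 2 = k :=
    fun {p} hp => by simpa using hDdeep (q := 0) hp h0D
  obtain ⟨w, hwM, hw⟩ := hmax u huM
  obtain ⟨h2u, a, ha⟩ := hDdeep0 huD
  obtain ⟨h2w, b, hb⟩ := hMdeep hwM
  -- Both `2u` and `2w` lie in `L`, so `4 * inner ℝ u w` is an integer; the choice of `w` makes it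
  -- odd.
  obtain ⟨k, hk⟩ : ∃ k : ℤ, 4 * inner ℝ u w = 2 * k + 1 := by
    obtain ⟨j, hj⟩ := hint h2u h2w
    rw [inner_smul_left, inner_smul_right] at hj
    simp only [conj_trivial] at hj
    rcases Int.even_or_odd' j with ⟨i, rfl | rfl⟩
    · refine absurd ?_ (hw i)
      push_cast at hj
      linarith
    · refine ⟨i, ?_⟩
      push_cast at hj
      linarith
  -- The squared norm of `u + w - l` lies in `ℤ + 1/2` and is at most 1, so it is `1 / 2`, and twice
  -- this vector is a root.
  obtain ⟨l, hl, hle⟩ := h.cover (u + w)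
  obtain ⟨r, hr⟩ : ∃ r, r = (2 : ℝ) • (u + w - l) := ⟨_, rfl⟩
  have h2l : (2 : ℝ) • l ∈ L := by simpa using intCast_smul_mem hl 2
  have hrL : r ∈ L := by
    rw [hr, smul_sub, smul_add]
    exact sub_mem (add_mem h2u h2w) h2l
  obtain ⟨i, hi⟩ := hint h2u hl
  obtain ⟨j, hj⟩ := hint h2w hl
  rw [inner_smul_left] at hi hj
  simp only [conj_trivial] at hi hj
  have hr2 : ‖r‖ ^ 2 = 2 := by
    obtain ⟨d, hd⟩ := heven l hl
    have hnorm : ‖r‖ ^ 2 = 4 * ‖u + w - l‖ ^ 2 := by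
      rw [hr, norm_smul, mul_pow]
      norm_num
    have hexp : ‖u + w - l‖ ^ 2 = (a + b + k + 2 * d - i - j : ℤ) + 1 / 2 := by
      rw [norm_sub_sq_real, norm_add_sq_real, inner_add_left, ha, hb, hd]
      push_cast
      linarith
    rw [div_self four_ne_zero] at hle
    obtain ⟨A, hA⟩ : ∃ A : ℤ, A = a + b + k + 2 * d - i - j := ⟨_, rfl⟩
    rw [← hA] at hexp
    have hA1 : A < 1 := by
      have : (A : ℝ) < 1 := by linarith
      exact_mod_cast this
    have hA2 : -1 < A := by
      have : (-1 : ℝ) < A := by linarith [sq_nonneg ‖u + w - l‖]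
      exact_mod_cast this
    have : A = 0 := by omega
    rw [hnorm, hexp, this]
    norm_num
  have hs := reflection_apply_of_norm_sq_eq_two hr2
  set s := (Submodule.span ℝ {r})ᗮ.reflection
  have hsL : ∀ v ∈ L, s v ∈ L := fun v hv => by
    obtain ⟨t, ht⟩ := hint hrL hv
    rw [hs, ht]
    exact sub_mem hv (intCast_smul_mem hrL t)
  obtain ⟨φ, hφ⟩ := exists_isometryEquiv_quotient (L := L) s fun v =>
    ⟨fun hv => by simpa [s] using hsL _ hv, hsL v⟩
  -- Such a point is orthogonal to `u` because both lie in `D`, and to `w` because both lie in `C`;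
  -- so its inner product with `r` is an integer.
  have hfix : ∀ x ∈ D, x ∈ C → φ x = x := by
    rintro _ hxD ⟨z, hz, rfl⟩
    obtain ⟨h2z, hz'⟩ := hMdeep hz
    obtain ⟨a', ha'⟩ := hpolar ⟨a, ha⟩ hz' (hDdeep huD hxD).2
    obtain ⟨b', hb'⟩ := hpolar ⟨b, hb⟩ hz' (hMdeep (sub_mem hwM hz)).2
    obtain ⟨c', hc'⟩ := hint hl h2z
    rw [inner_smul_right] at hc'
    have : inner ℝ r z = (a' + b' - c' : ℤ) := by
      rw [hr, inner_smul_left, inner_sub_left, inner_add_left]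
      simp only [conj_trivial]
      push_cast
      linarith
    change φ (z : V ⧸ L) = (z : V ⧸ L)
    rw [hφ, hs, this, QuotientAddGroup.mk_sub,
      (QuotientAddGroup.eq_zero_iff _).2 (intCast_smul_mem hrL _), sub_zero]
  -- Here `inner ℝ r u` is in `ℤ + 1/2`, so modulo `L` the reflection subtracts `r / 2 = u + w - l`
  -- from `u`, leaving `-w`.
  have hmove : φ (u : V ⧸ L) ∈ C := by
    refine ⟨-w, neg_mem hwM, ?_⟩
    have : inner ℝ r u = (2 * a + k - i : ℤ) + 1 / 2 := by
      rw [hr, inner_smul_left, inner_sub_left, inner_add_left, real_inner_self_eq_norm_sq, ha,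
        real_inner_comm u w, real_inner_comm u l]
      simp only [conj_trivial]
      push_cast
      linarith
    change ((-w : V) : V ⧸ L) = φ (u : V ⧸ L)
    rw [hφ, hs, this, QuotientAddGroup.eq_iff_sub_mem, add_smul]
    have : -w - (u - (((2 * a + k - i : ℤ) : ℝ) • r + (1 / 2 : ℝ) • r)) =
        ((2 * a + k - i : ℤ) : ℝ) • r - l := by
      rw [show (1 / 2 : ℝ) • r = u + w - l by rw [hr, smul_smul]; norm_num]
      abel
    rw [this]
    exact sub_mem (intCast_smul_mem hrL _) hl
  have hlt : (φ '' D \ C).ncard < (D \ C).ncard := by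
    have hsub : φ '' D \ C ⊆ φ '' ((D \ C) \ {(u : V ⧸ L)}) := by
      rintro _ ⟨⟨x, hx, rfl⟩, hxC⟩
      refine ⟨x, ⟨⟨hx, fun hc => hxC (by rwa [hfix x hx hc])⟩, ?_⟩, rfl⟩
      rintro rfl
      exact hxC hmove
    have hfin' : (D \ C).Finite := hfin.subset Set.sdiff_subset
    calc _ ≤ _ := Set.ncard_le_ncard hsub ((hfin'.subset Set.sdiff_subset).image φ)
      _ ≤ _ := Set.ncard_image_le (hfin'.subset Set.sdiff_subset)
      _ < _ := Set.ncard_sdiff_singleton_lt_of_mem ⟨huD, huC⟩ hfin'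
  obtain ⟨ψ, hψ⟩ := ih _ hlt (φ '' D) (hfin.image φ) ⟨0, h0D, by
      have := hφ 0
      rwa [map_zero] at this⟩ (by
    rintro _ ⟨x, hx, rfl⟩ _ ⟨y, hy, rfl⟩ hxy
    rw [← dist_eq_norm, φ.dist_eq, dist_eq_norm]
    exact hD x hx y hy fun e => hxy (by rw [e])) rfl
  refine ⟨φ.trans ψ, ?_⟩
  rw [← Set.image_comp] at hψ
  exact hψ

end EvenUnimodular

/-! ### The lattice `E₈`. -/

section EEight

theorem mem_latticeE8_iff {x : EuclideanSpace ℝ (Fin 8)} :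
    x ∈ latticeE8 ↔ ∃ k : Fin 8 → ℤ, Even (∑ i, k i) ∧
      ((∀ i, x i = k i) ∨ ∀ i, x i = k i + 1 / 2) := by
  constructor
  · rintro ⟨h | h, s, hs⟩
    · choose k hk using h
      simp_rw [hk] at hs
      exact ⟨k, ⟨s, by rw [← two_mul]; exact_mod_cast hs⟩, Or.inl hk⟩
    · choose k hk using h
      simp_rw [hk, Finset.sum_add_distrib] at hs
      refine ⟨k, ⟨s - 2, ?_⟩, Or.inr hk⟩
      have : ((∑ i, k i : ℤ) : ℝ) = (s - 2 + (s - 2) : ℤ) := by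
        push_cast
        simp at hs
        linarith
      exact_mod_cast this
  · rintro ⟨k, ⟨s, hs⟩, h | h⟩
    · refine ⟨Or.inl fun i => ⟨k i, h i⟩, s, ?_⟩
      simp_rw [h]
      rw [two_mul]
      exact_mod_cast hs
    · refine ⟨Or.inr fun i => ⟨k i, h i⟩, s + 2, ?_⟩
      simp_rw [h, Finset.sum_add_distrib]
      rw [← Int.cast_sum, hs]
      simp
      ring

theorem latticeD_eight_le_latticeE8 : latticeD 8 ≤ latticeE8 :=
  fun _ hx => ⟨Or.inl hx.1, hx.2⟩

theorem exists_norm_sq_eq_two_mul_of_mem_latticeE8 {v : EuclideanSpace ℝ (Fin 8)}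
    (hv : v ∈ latticeE8) : ∃ j : ℤ, ‖v‖ ^ 2 = 2 * j := by
  obtain ⟨k, hev, hk | hk⟩ := mem_latticeE8_iff.1 hv
  · exact exists_norm_sq_eq_two_mul_of_mem_latticeD (mem_latticeD_iff.2 ⟨k, hk, hev⟩)
  · obtain ⟨j, hj⟩ : Even (∑ i, k i * (k i + 1)) :=
      Finset.even_sum _ fun i _ => Int.even_mul_succ_self _
    refine ⟨j + 1, ?_⟩
    rw [EuclideanSpace.real_norm_sq_eq]
    have : ∀ i, v i ^ 2 = ((k i * (k i + 1) : ℤ) : ℝ) + 1 / 4 := fun i => by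
      rw [hk]
      push_cast
      ring
    simp_rw [this, Finset.sum_add_distrib]
    rw [← Int.cast_sum, hj]
    simp
    ring

/-- Roots of `D₈` force the coordinates to be all integers or all half-integers; the vector `(1/2,
…, 1/2)` forces the even sum. -/
theorem mem_latticeE8_of_forall_inner {u : EuclideanSpace ℝ (Fin 8)}
    (h : ∀ v ∈ latticeE8, ∃ k : ℤ, inner ℝ u v = k) : u ∈ latticeE8 := by
  have hpair : ∀ i j : Fin 8, ∀ a b : ℤ, Even (a + b) → ∃ k : ℤ, a * u i + b * u j = k := by
    intro i j a b hab
    obtain ⟨k, hk⟩ := h _ (latticeD_eight_le_latticeE8 (single_add_single_mem_latticeD i j hab))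
    refine ⟨k, ?_⟩
    rw [← hk, inner_add_right]
    simp [EuclideanSpace.inner_single_right]
  obtain ⟨z, hz⟩ := hpair 0 0 1 1 (by decide)
  have hsub : ∀ i, ∃ k : ℤ, u i - u 0 = k := fun i => by
    obtain ⟨k, hk⟩ := hpair i 0 1 (-1) (by decide)
    exact ⟨k, by rw [← hk]; push_cast; ring⟩
  choose d hd using hsub
  refine ⟨?_, ?_⟩
  · rcases Int.even_or_odd' z with ⟨t, rfl | rfl⟩
    · refine Or.inl fun i => ⟨t + d i, ?_⟩
      push_cast at hz ⊢
      linarith [hd i]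
    · refine Or.inr fun i => ⟨t + d i, ?_⟩
      push_cast at hz ⊢
      linarith [hd i]
  · obtain ⟨s, hs⟩ := h (WithLp.toLp 2 fun _ => 1 / 2)
      (mem_latticeE8_iff.2 ⟨fun _ => 0, by simp, Or.inr fun i => by simp⟩)
    refine ⟨s, ?_⟩
    rw [← hs, EuclideanSpace.real_inner_eq_sum]
    simp [← Finset.sum_mul]
    ring

/-- The two largest coordinates `x ≥ t` and the smallest coordinate `m` bound the squared norm. -/
theorem voronoi_bound {x t m : ℝ} (hm : 0 ≤ m) (hmt : m ≤ t) (htx : t ≤ x) (hxt : x + t ≤ 1) :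
    x ^ 2 + (m + t) * (2 + 2 * m - x) - 7 * (m * t) ≤ 1 ∧
      (1 ≤ x ^ 2 + (m + t) * (2 + 2 * m - x) - 7 * (m * t) →
        x = 1 - t ∧ (t = m ∨ (t = 1 / 2 ∧ m = 0))) := by
  obtain ⟨F, hF⟩ : ∃ F, F = x ^ 2 + (m + t) * (2 + 2 * m - x) - 7 * (m * t) := ⟨_, rfl⟩
  rw [← hF]
  have ht : t ≤ 1 / 2 := by linarith
  rcases ht.eq_or_lt with rfl | ht
  · have hx : x = 1 / 2 := by linarith
    subst hx
    have e : 1 - F = (1 / 2 - m) * (2 * m) := by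
      rw [hF]
      ring
    have h0 : 0 ≤ (1 / 2 - m) * (2 * m) := mul_nonneg (by linarith) (by linarith)
    refine ⟨by linarith, fun h1 => ⟨by norm_num, ?_⟩⟩
    have h2 : (1 / 2 - m) * (2 * m) = 0 := by linarith
    rcases mul_eq_zero.1 h2 with h3 | h3
    · left
      linarith
    · right
      exact ⟨rfl, by linarith⟩
  -- `F` is a monic quadratic in `x`, hence its linear interpolation between `x = t` and `x = 1 - t`
  -- minus `(x - t) * (1 - t - x)`. The last two terms carry the values of `1 - F` at these ends,
  -- which coincide when `t = 1 / 2`.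
  · have e : (1 - 2 * t) * (1 - F) = (1 - 2 * t) * ((x - t) * (1 - t - x)) +
        (1 - t - x) * ((1 - 2 * t) * (1 - 2 * m) + 2 * m * (t - m)) +
        (x - t) * ((t - m) * (1 - 2 * (t - m))) := by
      rw [hF]
      ring
    have p1 : 0 ≤ (1 - 2 * t) * ((x - t) * (1 - t - x)) :=
      mul_nonneg (by linarith) (mul_nonneg (by linarith) (by linarith))
    have p2 : 0 < (1 - 2 * t) * (1 - 2 * m) + 2 * m * (t - m) :=
      add_pos_of_pos_of_nonneg (mul_pos (by linarith) (by linarith))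
        (mul_nonneg (by linarith) (by linarith))
    have p3 : 0 ≤ (1 - t - x) * ((1 - 2 * t) * (1 - 2 * m) + 2 * m * (t - m)) :=
      mul_nonneg (by linarith) p2.le
    have p4 : 0 ≤ (x - t) * ((t - m) * (1 - 2 * (t - m))) :=
      mul_nonneg (by linarith) (mul_nonneg (by linarith) (by linarith))
    have p5 : 0 < 1 - 2 * t := by linarith
    have hle : 0 ≤ 1 - F := nonneg_of_mul_nonneg_right (by linarith) p5
    refine ⟨by linarith, fun h1 => ?_⟩
    have h0 : (1 - 2 * t) * (1 - F) = 0 := by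
      rw [show 1 - F = 0 by linarith, mul_zero]
    have q3 : (1 - t - x) * ((1 - 2 * t) * (1 - 2 * m) + 2 * m * (t - m)) = 0 := by linarith
    have q4 : (x - t) * ((t - m) * (1 - 2 * (t - m))) = 0 := by linarith
    have hx : 1 - t - x = 0 := (mul_eq_zero.1 q3).resolve_right p2.ne'
    refine ⟨by linarith, Or.inl ?_⟩
    have h2 : (t - m) * (1 - 2 * (t - m)) = 0 :=
      (mul_eq_zero.1 q4).resolve_left (by linarith)
    have := (mul_eq_zero.1 h2).resolve_right (by linarith)
    linarith

/-- With `x ≥ t` the two largest coordinates, the other entries lie in `[m, t]`, so `(u l - m) * (t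
- u l) ≥ 0` bounds their squares linearly. Summing over all seven indices other than that of `x` and
using `hsum` gives the expression in `voronoi_bound`. -/
theorem sum_sq_le_one_of_sum_le {u : Fin 8 → ℝ} {m : ℝ} (hm : 0 ≤ m) (hu : ∀ i, m ≤ u i)
    (h : ∀ i j, i ≠ j → u i + u j ≤ 1) (hsum : ∑ i, u i ≤ 2 + 2 * m) :
    ∑ i, u i ^ 2 ≤ 1 ∧ (1 ≤ ∑ i, u i ^ 2 →
      (∀ i, u i = 0 ∨ u i = 1 / 2) ∨ (∃ i, u i = 1 ∧ ∀ j, j ≠ i → u j = 0) ∨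
      (m = 1 / 4 ∧ ∃ i, u i = 3 / 4 ∧ ∀ j, j ≠ i → u j = 1 / 4)) := by
  obtain ⟨i, -, hi⟩ := Finset.exists_max_image Finset.univ u Finset.univ_nonempty
  obtain ⟨j, hj, hjmax⟩ := Finset.exists_max_image (Finset.univ.erase i) u
    ⟨i + 1, by simp⟩
  have hij : j ≠ i := Finset.ne_of_mem_erase hj
  obtain ⟨hF, hFeq⟩ := voronoi_bound hm (hu j) (hi j (Finset.mem_univ j)) (h i j hij.symm)
  rw [← Finset.add_sum_erase _ _ (Finset.mem_univ i)] at hsum ⊢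
  have hprod : ∀ l ∈ Finset.univ.erase i, 0 ≤ (u l - m) * (u j - u l) := fun l hl =>
    mul_nonneg (sub_nonneg.2 (hu l)) (sub_nonneg.2 (hjmax l hl))
  have hcard : (Finset.univ.erase i).card = 7 := by simp
  have hexp : ∑ l ∈ Finset.univ.erase i, (u l - m) * (u j - u l) =
      (m + u j) * ∑ l ∈ Finset.univ.erase i, u l - ∑ l ∈ Finset.univ.erase i, u l ^ 2 -
        7 * (m * u j) := by
    have : ∀ l, (u l - m) * (u j - u l) = (m + u j) * u l - u l ^ 2 - m * u j := fun l => by ring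
    simp_rw [this, Finset.sum_sub_distrib, Finset.mul_sum, Finset.sum_const, hcard]
    norm_num
  have hsum0 := Finset.sum_nonneg hprod
  set R := ∑ l ∈ Finset.univ.erase i, u l with hR
  have hmul : (m + u j) * R ≤ (m + u j) * (2 + 2 * m - u i) :=
    mul_le_mul_of_nonneg_left (by linarith) (by linarith [hu j])
  refine ⟨by linarith, fun h1 => ?_⟩
  obtain ⟨hx, ht⟩ := hFeq (by linarith)
  rcases ht with ht | ⟨ht, rfl⟩
  · have hall : ∀ l, l ≠ i → u l = u j := fun l hl =>
      le_antisymm (hjmax l (Finset.mem_erase.2 ⟨hl, Finset.mem_univ l⟩)) (ht ▸ hu l)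
    have hR7 : R = 7 * u j := by
      rw [hR, Finset.sum_congr rfl fun l hl => hall l (Finset.ne_of_mem_erase hl),
        Finset.sum_const, hcard]
      norm_num
    have heq : (m + u j) * R = (m + u j) * (2 + 2 * m - u i) := by linarith
    rcases eq_or_ne (u j) 0 with h0 | h0
    · refine Or.inr (Or.inl ⟨i, by linarith, fun l hl => by rw [hall l hl, h0]⟩)
    · have hne : m + u j ≠ 0 := by
        rw [← ht]
        intro h2
        exact h0 (by linarith)
      have := mul_left_cancel₀ hne heq
      have h4 : u j = 1 / 4 := by linarith
      exact Or.inr (Or.inr ⟨by linarith, i, by linarith, fun l hl => by rw [hall l hl, h4]⟩)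
  · left
    intro l
    rcases eq_or_ne l i with rfl | hl
    · right
      linarith
    · have hz : ∑ l ∈ Finset.univ.erase i, (u l - 0) * (u j - u l) = 0 := by linarith
      have := (Finset.sum_eq_zero_iff_of_nonneg hprod).1 hz l
        (Finset.mem_erase.2 ⟨hl, Finset.mem_univ l⟩)
      rcases mul_eq_zero.1 this with h2 | h2
      · left
        linarith
      · right
        linarith

/-- The integer vector `2y` has sum of squares 4, hence an even coordinate sum. -/
theorem two_smul_mem_latticeE8_of_abs_half {y : EuclideanSpace ℝ (Fin 8)} (hy : ‖y‖ ^ 2 = 1)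
    (h : ∀ i, |y i| = 0 ∨ |y i| = 1 / 2) : (2 : ℝ) • y ∈ latticeE8 := by
  have : ∀ i, ∃ k : ℤ, y i = k / 2 := fun i => by
    rcases h i with h | h
    · exact ⟨0, by simpa using h⟩
    · rcases eq_or_eq_neg_of_abs_eq h with h | h
      · exact ⟨1, by rw [h]; norm_num⟩
      · exact ⟨-1, by rw [h]; norm_num⟩
  choose k hk using this
  refine mem_latticeE8_iff.2 ⟨k, ?_, Or.inl fun i => by simp [hk]; ring⟩
  have h4 : ∑ i, k i ^ 2 = 4 := by
    rw [EuclideanSpace.real_norm_sq_eq] at hy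
    simp_rw [hk, div_pow, ← Finset.sum_div] at hy
    have : ((∑ i, k i ^ 2 : ℤ) : ℝ) = 4 := by
      push_cast
      linarith
    exact_mod_cast this
  have hev : Even (∑ i, (k i ^ 2 - k i)) := Finset.even_sum _ fun i _ => Int.even_sub_sq _
  rw [Finset.sum_sub_distrib, h4] at hev
  exact (Int.even_sub.1 hev).1 (by decide)

/-- Write the sign of `y i` as `2 * k i + 1`. If the number of minus signs is even, half the sign
vector is a root and gives `∑ |y i| ≤ 2`. If it is odd, flipping the sign at the smallest coordinate
`|y m|` gives `∑ |y i| ≤ 2 + 2 * |y m|`. -/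
theorem reduced_latticeE8 {y : EuclideanSpace ℝ (Fin 8)}
    (hy : ∀ w ∈ latticeE8, 2 * inner ℝ y w ≤ ‖w‖ ^ 2) :
    ‖y‖ ^ 2 ≤ 1 ∧ (1 ≤ ‖y‖ ^ 2 → (2 : ℝ) • y ∈ latticeE8) := by
  have hsign : ∀ i, ∃ k : ℤ, (2 * k + 1 : ℤ) ^ 2 = 1 ∧ y i = (2 * k + 1) * |y i| := fun i => by
    rcases le_total 0 (y i) with h | h
    · exact ⟨0, by norm_num, by simp [abs_of_nonneg h]⟩
    · exact ⟨-1, by norm_num, by rw [abs_of_nonpos h]; norm_num⟩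
  choose k hk1 hk using hsign
  have hk1' : ∀ i, (2 * (k i : ℝ) + 1) ^ 2 = 1 := fun i => by exact_mod_cast hk1 i
  have habs : ∀ i, (2 * (k i : ℝ) + 1) * y i = |y i| := fun i => by
    have h1 := hk i
    calc (2 * (k i : ℝ) + 1) * y i = (2 * (k i : ℝ) + 1) * ((2 * k i + 1) * |y i|) := by rw [← h1]
      _ = (2 * (k i : ℝ) + 1) ^ 2 * |y i| := by ring
      _ = |y i| := by rw [hk1', one_mul]
  have hpair : ∀ i j : Fin 8, i ≠ j → |y i| + |y j| ≤ 1 := fun i j hij =>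
    abs_add_abs_le_one_of_reduced latticeD_eight_le_latticeE8 hy hij
  -- the closest vector of `(ℤ + 1/2)^8`, up to sign changes
  have hhalf : ∀ f : Fin 8 → ℤ, Even (∑ i, f i) → (∀ i, (2 * (f i : ℝ) + 1) ^ 2 = 1) →
      ∑ i, (2 * (f i : ℝ) + 1) * y i ≤ 2 := by
    intro f hf hf1
    have := hy (WithLp.toLp 2 fun i => (f i : ℝ) + 1 / 2)
      (mem_latticeE8_iff.2 ⟨f, hf, Or.inr fun i => rfl⟩)
    rw [EuclideanSpace.real_inner_eq_sum, EuclideanSpace.real_norm_sq_eq, Finset.mul_sum] at this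
    have h2 : ∀ i, ((f i : ℝ) + 1 / 2) ^ 2 = 1 / 4 := fun i => by linarith [hf1 i]
    simp only [h2] at this
    rw [Finset.sum_congr rfl fun i _ =>
      show (2 * (f i : ℝ) + 1) * y i = 2 * (y i * ((f i : ℝ) + 1 / 2)) by ring]
    refine this.trans ?_
    norm_num
  have hone : ∀ i, |y i| = 1 → (∀ j, j ≠ i → |y j| = 0) → (2 : ℝ) • y ∈ latticeE8 := by
    intro i hi h0
    refine mem_latticeE8_iff.2 ⟨Pi.single i (2 * (2 * k i + 1)), ?_, Or.inl fun j => ?_⟩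
    · simp
    · rcases eq_or_ne j i with rfl | hj
      · have := hk j
        rw [hi, mul_one] at this
        simp [this]
      · simp [abs_eq_zero.1 (h0 j hj), hj]
  have hnorm : ‖y‖ ^ 2 = ∑ i, |y i| ^ 2 := by
    simp_rw [sq_abs]
    exact EuclideanSpace.real_norm_sq_eq y
  rcases Int.even_or_odd (∑ i, k i) with hev | hodd
  · have hsum := hhalf k hev hk1'
    simp_rw [habs] at hsum
    obtain ⟨h1, h2⟩ := sum_sq_le_one_of_sum_le (u := fun i => |y i|) le_rfl
      (fun i => abs_nonneg _) hpair (by simpa using hsum)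
    rw [← hnorm] at h1 h2
    refine ⟨h1, fun h => ?_⟩
    rcases h2 h with h3 | ⟨i, hi, h0⟩ | ⟨h3, -⟩
    · exact two_smul_mem_latticeE8_of_abs_half (le_antisymm h1 h) h3
    · exact hone i hi h0
    · norm_num at h3
  · obtain ⟨m, -, hm⟩ := Finset.exists_min_image Finset.univ (fun i => |y i|)
      Finset.univ_nonempty
    have hsum : ∑ i, |y i| ≤ 2 + 2 * |y m| := by
      -- Replacing `k m` by `-1 - k m` flips that sign and changes the parity of the sum.
      have hflip : ∀ i, 2 * (((k + Pi.single m (-1 - 2 * k m) : Fin 8 → ℤ) i : ℤ) : ℝ) + 1 =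
          (2 * (k i : ℝ) + 1) * (if i = m then -1 else 1) := fun i => by
        rcases eq_or_ne i m with rfl | hi
        · simp
          ring
        · simp [hi]
      have := hhalf (k + Pi.single m (-1 - 2 * k m)) ?_ fun i => ?_
      · have h2 : ∀ i, (2 * (k i : ℝ) + 1) * (if i = m then -1 else 1) * y i =
            |y i| - if i = m then 2 * |y m| else 0 := fun i => by
          rw [mul_right_comm, habs]
          split_ifs with h
          · rw [h]
            ring
          · ring
        simp_rw [hflip, h2, Finset.sum_sub_distrib] at this
        simp at this
        linarith
      · simp only [Pi.add_apply, Finset.sum_add_distrib, Finset.sum_pi_single', Finset.mem_univ,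
          if_true]
        refine hodd.add_odd ⟨-1 - k m, by ring⟩
      · rw [hflip, mul_pow, hk1', one_mul]
        split_ifs <;> norm_num
    obtain ⟨h1, h2⟩ := sum_sq_le_one_of_sum_le (u := fun i => |y i|) (abs_nonneg (y m))
      (fun i => hm i (Finset.mem_univ i)) hpair hsum
    rw [← hnorm] at h1 h2
    refine ⟨h1, fun h => ?_⟩
    rcases h2 h with h3 | ⟨i, hi, h0⟩ | ⟨-, i, hi, h4⟩
    · exact two_smul_mem_latticeE8_of_abs_half (le_antisymm h1 h) h3
    · exact hone i hi h0
    -- Here `2y` has entries `±3/2` at `i` and `±1/2` elsewhere; tripling the half-sign at `i` adds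
    -- the odd number `2 * k i + 1` and makes the sum even.
    · refine mem_latticeE8_iff.2 ⟨k + Pi.single i (2 * k i + 1), ?_, Or.inr fun j => ?_⟩
      · simp only [Pi.add_apply, Finset.sum_add_distrib, Finset.sum_pi_single', Finset.mem_univ,
          if_true]
        exact hodd.add_odd ⟨k i, rfl⟩
      · have := hk j
        rcases eq_or_ne j i with rfl | hj
        · rw [hi] at this
          simp [this]
          ring
        · rw [h4 j hj] at this
          simp [this, hj]
          ring

/-- A similarity of norm `2` that maps `E₈` into itself. -/
noncomputable def butterflyEight : EuclideanSpace ℝ (Fin 8) →ₗ[ℝ] EuclideanSpace ℝ (Fin 8) where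
  toFun x := !₂[x 0 + x 1, x 0 - x 1, x 2 + x 3, x 2 - x 3,
    x 4 + x 5, x 4 - x 5, x 6 + x 7, x 6 - x 7]
  map_add' x y := by
    ext i
    fin_cases i <;> simp <;> ring
  map_smul' r x := by
    ext i
    fin_cases i <;> simp <;> ring

theorem butterflyEight_mem {v : EuclideanSpace ℝ (Fin 8)} (hv : v ∈ latticeE8) :
    butterflyEight v ∈ latticeE8 := by
  obtain ⟨k, hev, hk | hk⟩ := mem_latticeE8_iff.1 hv
  · refine mem_latticeE8_iff.2 ⟨![k 0 + k 1, k 0 - k 1, k 2 + k 3, k 2 - k 3,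
      k 4 + k 5, k 4 - k 5, k 6 + k 7, k 6 - k 7], ?_, Or.inl fun i => ?_⟩
    · rw [Fin.sum_univ_eight]
      exact ⟨k 0 + k 2 + k 4 + k 6, by simp; ring⟩
    · fin_cases i <;> simp [butterflyEight, hk]
  · refine mem_latticeE8_iff.2 ⟨![k 0 + k 1 + 1, k 0 - k 1, k 2 + k 3 + 1, k 2 - k 3,
      k 4 + k 5 + 1, k 4 - k 5, k 6 + k 7 + 1, k 6 - k 7], ?_, Or.inl fun i => ?_⟩
    · rw [Fin.sum_univ_eight]
      exact ⟨k 0 + k 2 + k 4 + k 6 + 2, by simp; ring⟩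
    · fin_cases i <;> simp [butterflyEight, hk] <;> ring

theorem hasTightSublattice_latticeE8 : HasTightSublattice latticeE8 4 16 where
  two_lt := by norm_num
  two_le := by norm_num
  sq_card := by
    rw [finrank_euclideanSpace]
    norm_num
  exists_norm_sq_eq_two := ⟨_, latticeD_eight_le_latticeE8
    (single_add_single_mem_latticeD 0 1 (a := 1) (b := 1) (by decide)), by
      rw [norm_sq_single_add_single (by decide)]
      norm_num⟩
  exists_norm_sq_eq := ⟨_, latticeD_eight_le_latticeE8
    (toLp_mem_latticeD (k := ![1, 1, 1, 1, 0, 0, 0, 0]) (by decide)), by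
      rw [EuclideanSpace.real_norm_sq_eq, Fin.sum_univ_eight]
      simp
      norm_num⟩
  norm_sq_gap v hv := norm_sq_eq_two_or_four_le (exists_norm_sq_eq_two_mul_of_mem_latticeE8 hv)
  cover := by
    intro x
    have : DiscreteTopology latticeE8 := discreteTopology_of_le_norm_sq two_pos
      fun v hv hne => by
        rcases norm_sq_eq_two_or_four_le (exists_norm_sq_eq_two_mul_of_mem_latticeE8 hv) hne
          with h | h <;> linarith
    obtain ⟨v, hv, hred⟩ := exists_two_mul_inner_le latticeE8 x
    refine ⟨v, hv, ?_⟩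
    rw [div_self four_ne_zero]
    exact (reduced_latticeE8 hred).1
  similar := by
    refine ⟨butterflyEight, fun x => ?_, fun _ => butterflyEight_mem⟩
    simp only [EuclideanSpace.real_norm_sq_eq, Fin.sum_univ_eight, butterflyEight]
    simp
    ring

end EEight

theorem theorem4p12 :
    (IsLeast (codeSizes (latticeA 1) \ {1}) ((2 : ℕ) : ℝ) ∧
      LatticeCodeUniquelyOptimal (latticeA 1) 2) ∧
    (IsLeast (codeSizes (latticeA 2) \ {1}) ((3 : ℕ) : ℝ) ∧
      LatticeCodeUniquelyOptimal (latticeA 2) 3) ∧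
    (IsLeast (codeSizes (latticeD 4) \ {1}) ((4 : ℕ) : ℝ) ∧
      LatticeCodeUniquelyOptimal (latticeD 4) 4) ∧
    (IsLeast (codeSizes latticeE8 \ {1}) ((16 : ℕ) : ℝ) ∧
      LatticeCodeUniquelyOptimal latticeE8 16) :=
  ⟨⟨hasTightSublattice_latticeA_one.isLeast_codeSizes, latticeCodeUniquelyOptimal_latticeA_one⟩,
    ⟨hasTightSublattice_latticeA_two.isLeast_codeSizes, latticeCodeUniquelyOptimal_latticeA_two⟩,
    ⟨hasTightSublattice_latticeD_four.isLeast_codeSizes, latticeCodeUniquelyOptimal_latticeD_four⟩,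
    hasTightSublattice_latticeE8.isLeast_codeSizes,
    latticeCodeUniquelyOptimal_of_even_of_selfDual hasTightSublattice_latticeE8
      (fun _ => exists_norm_sq_eq_two_mul_of_mem_latticeE8)
      (fun _ => mem_latticeE8_of_forall_inner) fun _ hy => (reduced_latticeE8 hy).2⟩
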